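/- **Model.** Let $U^1,U^2,\dots$ be i.i.d. centred Gaussian vectors in $\mathbb R^n$ with covariance matrix $\Sigma_S$, where $(\Sigma_S)_{ii}=1$, $(\Sigma_S)_{ij}=\rho$ for distinct $i,j\in S$, and $(\Sigma_S)_{ij}=0$ otherwise, with $\rho>0$. Put $\tilde n=\lfloor n/k\rfloor$ and $I_j=\{(j-1)k+1,\dots,jk\}$ for $1\le j\le\tilde n$; one tests $S=\emptyset$ against $S\in\mathcal D_{[k]}=\{I_1,\dots,I_{\tilde n}\}$. At round $t=1,\dots,M$ one may query a set $A^t\subseteq[n]$, chosen as a function of the past queries and observations, and observes the coordinates of $U^t$ in $A^t$ only; the budget constraint is $\sum_t|A^t|\le M$, and $m=M/n$. The risk of a procedure is the probability of rejecting when $S=\emptyset$ plus the maximum over $S\in\mathcal D_{[k]}$ of the probability of not rejecting. **Procedure.** Fix $\varepsilon>0$. Sequential thresholding for disjoint $k$-intervals uses $K=\lfloor(1+\varepsilon)\log_2\tilde n\rfloor$ steps and $\bar m=\lfloor m/4\rfloor$ observations per step. Let $f_0$ and $f_1$ be the densities on $\mathbb R^k$ of the centred Gaussian laws with covariance the identity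 and covariance $J$ ($J_{ii}=1$, $J_{ij}=\rho$ for $i\neq j$) respectively, and let $\gamma$ be the median of $\prod_{t=1}^{\bar m} f_1(z^t)/f_0(z^t)$ for i.i.d. $z^t\sim f_0$. Start with $\mathcal S_0=\{1,\dots,\tilde n\}$. At step $r=1,\dots,K$, observe each interval $I_i$, $i\in\mathcal S_{r-1}$, in $\bar m$ fresh rounds, and let $\mathcal S_r$ be the set of those $i\in\mathcal S_{r-1}$ for which the likelihood ratio $\prod_t f_1/f_0$ of these $\bar m$ observations exceeds $\gamma$. As soon as $\sum_{s=0}^{r}|\mathcal S_s|>4\tilde n$, stop querying and report no detection. Otherwise report detection if and only if $\mathcal S_K\ne\emptyset$. **Statement.** There are numerical constants $C_3,C_4>0$ such that, for every $\varepsilon>0$ and all sequences of parameters $(n,k,M,\rho)$ with $n,k,m\to\infty$, $k/n\to0$, $\rho>0$ and $\rho\to0$: if either $$\rho k\to\infty\quad\text{and}\quad m\log(1+\rho k)\ \ge\ C_3\log\log(n/k),$$ or $$\rho k\to0\quad\text{and}\quad \rho k\sqrt m\ \ge\ C_4\sqrt{\log\log(n/k)},$$ (the inequalities being required for all sufficiently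 large indices), then sequential thresholding for disjoint $k$-intervals always respects the budget of $M$ coordinate measurements, and its risk converges to zero. -/

import Mathlib

open MeasureTheory ProbabilityTheory Filter Topology
open scoped ENNReal

noncomputable section

namespace CorrDetect

/-! ### The correlation model -/

/-- The covariance matrix `Σ_S`: unit diagonal, `ρ` between distinct elements of `S`, and `0`
elsewhere. -/
def corrMatrix {ι : Type*} [DecidableEq ι] (S : Finset ι) (ρ : ℝ) : Matrix ι ι ℝ :=
  Matrix.of fun i j => if i = j then 1 else if i ∈ S ∧ j ∈ S then ρ else 0

/-- The law of one vector `U^t`: the centred Gaussian law with covariance matrix `Σ_S`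
(`S = ∅` is the null hypothesis). -/
def sampleLaw {ι : Type*} [Fintype ι] [DecidableEq ι] (S : Finset ι) (ρ : ℝ) :
    Measure (EuclideanSpace ℝ ι) :=
  multivariateGaussian 0 (corrMatrix S ρ)

/-- The law of the whole i.i.d. sequence `(U^t)` of vectors with contaminated set `S`. -/
def pathLaw {n : ℕ} (S : Finset (Fin n)) (ρ : ℝ) : Measure (ℕ → EuclideanSpace ℝ (Fin n)) :=
  Measure.infinitePi fun _ : ℕ => sampleLaw S ρ

/-- The `j`-th of the consecutive disjoint intervals of length `k` (coordinates and intervals are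
numbered from `0`). -/
def interval (n k : ℕ) (j : Fin (n / k)) : Finset (Fin n) :=
  Finset.univ.filter fun i => (j : ℕ) * k ≤ (i : ℕ) ∧ (i : ℕ) < ((j : ℕ) + 1) * k

/-- The class of disjoint `k`-intervals. -/
def disjointIntervals (n k : ℕ) : Finset (Finset (Fin n)) :=
  Finset.univ.image (interval n k)

/-! ### Adaptive sensing -/

/-- What is seen when the coordinates in `A` of `u` are queried: the coordinates outside `A` are
replaced by `0`. -/
def observe {n : ℕ} (A : Finset (Fin n)) (u : EuclideanSpace ℝ (Fin n)) :
    EuclideanSpace ℝ (Fin n) :=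
  WithLp.toLp 2 fun i => if i ∈ A then u i else 0

/-- A history: the list of the past queries and of the corresponding observations. -/
abbrev History (n : ℕ) : Type := List (Finset (Fin n) × EuclideanSpace ℝ (Fin n))

/-- An adaptive testing procedure (without additional randomization): the next query is a
function of the history, and the final decision is a function of the final history
(`true` means that the null hypothesis is rejected). -/
structure Procedure (n : ℕ) where
  /-- The next query. -/
  query : History n → Finset (Fin n)
  /-- The final decision. -/
  decision : History n → Bool

/-- The history after `t` rounds, when the underlying vectors are `u 0, u 1, …`. -/
def Procedure.history {n : ℕ} (P : Procedure n) (u : ℕ → EuclideanSpace ℝ (Fin n)) :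
    ℕ → History n
  | 0 => []
  | t + 1 => P.history u t ++ [(P.query (P.history u t), observe (P.query (P.history u t)) (u t))]

/-- The procedure, run for `M` rounds, never queries more than `M` coordinates in total. -/
def Procedure.HasBudget {n : ℕ} (P : Procedure n) (M : ℕ) : Prop :=
  ∀ u : ℕ → EuclideanSpace ℝ (Fin n), ((P.history u M).map fun o => o.1.card).sum ≤ M

/-- The worst-case risk over the class `𝒞` of a procedure run for `M` rounds: the probability of
rejecting under the null, plus the largest probability over `𝒞` of not rejecting. -/
def Procedure.risk {n : ℕ} (P : Procedure n) (M : ℕ) (𝒞 : Finset (Finset (Fin n))) (ρ : ℝ) :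
    ℝ≥0∞ :=
  pathLaw ∅ ρ {u | P.decision (P.history u M) ≠ false} +
    ⨆ S ∈ 𝒞, pathLaw S ρ {u | P.decision (P.history u M) ≠ true}

/-! ### Likelihood ratios -/

/-- The density with respect to Lebesgue measure of the centred Gaussian law on `ℝ^k` with
(nonsingular) covariance matrix `V`. -/
def gaussianDensity {k : ℕ} (V : Matrix (Fin k) (Fin k) ℝ) (z : EuclideanSpace ℝ (Fin k)) : ℝ :=
  (Real.sqrt ((2 * Real.pi) ^ k * V.det))⁻¹ *
    Real.exp (-(1 / 2) * dotProduct z.ofLp (V⁻¹.mulVec z.ofLp))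

/-- The likelihood ratio of the sample `z 0, …, z (b - 1)` of one interval: contaminated over
uncontaminated. -/
def likelihoodRatio {k : ℕ} (ρ : ℝ) {b : ℕ} (z : Fin b → EuclideanSpace ℝ (Fin k)) : ℝ :=
  (∏ t, gaussianDensity (corrMatrix Finset.univ ρ) (z t)) /
    ∏ t, gaussianDensity (corrMatrix ∅ ρ) (z t)

/-- The (smallest) median of a probability measure on `ℝ`. -/
def median (μ : Measure ℝ) : ℝ := sInf {x : ℝ | 1 / 2 ≤ μ (Set.Iic x)}

/-- The median of the likelihood ratio of `b` independent uncontaminated observations of one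
interval of length `k`. -/
def threshold (k : ℕ) (ρ : ℝ) (b : ℕ) : ℝ :=
  median ((Measure.pi fun _ : Fin b => sampleLaw (∅ : Finset (Fin k)) ρ).map (likelihoodRatio ρ))

/-! ### Sequential thresholding for disjoint `k`-intervals -/

lemma block_index_lt {n k : ℕ} (j : Fin (n / k)) (a : Fin k) : (j : ℕ) * k + (a : ℕ) < n := by
  have h1 : ((j : ℕ) + 1) * k ≤ n / k * k := Nat.mul_le_mul_right k j.isLt
  have h2 : n / k * k ≤ n := Nat.div_mul_le_self n k
  have h3 := a.isLt
  rw [Nat.add_mul] at h1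
  omega

/-- The subvector of `x` on the `j`-th interval. -/
def block {n k : ℕ} (x : EuclideanSpace ℝ (Fin n)) (j : Fin (n / k)) : EuclideanSpace ℝ (Fin k) :=
  WithLp.toLp 2 fun a => x ⟨(j : ℕ) * k + (a : ℕ), block_index_lt j a⟩

/-- The intervals that survive the first `r` steps, where step number `r` (numbered from `0`)
uses the `b` observations `x (r * b), …, x (r * b + b - 1)` and keeps the surviving intervals
whose likelihood ratio exceeds the threshold. -/
def survivors (n k : ℕ) (ρ : ℝ) (b : ℕ) (x : ℕ → EuclideanSpace ℝ (Fin n)) :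
    ℕ → Finset (Fin (n / k))
  | 0 => Finset.univ
  | r + 1 => (survivors n k ρ b x r).filter fun j =>
      threshold k ρ b < likelihoodRatio ρ fun t : Fin b => block (x (r * b + (t : ℕ))) j

/-- The total number of intervals in the sets of survivors from stage `0` to stage `r`. -/
def totalSurvivors (n k : ℕ) (ρ : ℝ) (b : ℕ) (x : ℕ → EuclideanSpace ℝ (Fin n)) (r : ℕ) : ℕ :=
  ∑ s ∈ Finset.range (r + 1), (survivors n k ρ b x s).card

/-- The observations recorded in a history. -/
def History.obs {n : ℕ} (h : History n) (t : ℕ) : EuclideanSpace ℝ (Fin n) := (h.getD t (∅, 0)).2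

/-- Sequential thresholding for disjoint `k`-intervals with `K` steps, each of which observes
every surviving interval `b` times. The procedure gives up (no more queries, no detection) as soon
as the total number of survivors exceeds four times the number of intervals; otherwise it calls
detection if some interval survives the `K` steps. -/
def thresholdingProcedure (n k : ℕ) (ρ : ℝ) (K b : ℕ) : Procedure n where
  query h :=
    if h.length < K * b ∧ totalSurvivors n k ρ b h.obs (h.length / b) ≤ 4 * (n / k) then
      (survivors n k ρ b h.obs (h.length / b)).biUnion (interval n k)
    else ∅
  decision h :=
    decide (totalSurvivors n k ρ b h.obs K ≤ 4 * (n / k) ∧ (survivors n k ρ b h.obs K).Nonempty)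

/-- Sequential thresholding with a total budget of `M = m n` coordinates: there are
`⌊(1 + ε) log₂ ⌊n/k⌋⌋` steps, each of which observes every surviving interval
`⌊m / 4⌋ = ⌊M / (4 n)⌋` times. -/
def sequentialThresholding (n k M : ℕ) (ρ ε : ℝ) : Procedure n :=
  thresholdingProcedure n k ρ ⌊(1 + ε) * Real.logb 2 ((n / k : ℕ) : ℝ)⌋₊ (M / (4 * n))

end CorrDetect

end

noncomputable section

namespace CorrDetect

/-! ### Densities of Gaussian laws -/

/-! Write N for the number of intervals, K for the number of steps and b for the number of
observations per step. Three estimates suffice.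

False alarms: the threshold is a null median, so a clean interval passes each step with probability
at most 1/2. Steps use fresh rounds, so some interval survives all K steps under the null with
probability at most N 2^(-K), which is at most 2 N^(-ε) (`pathLaw_empty_decision_le`,
`tendsto_mul_half_pow_stepCount`).

Misses: let h be the Hellinger affinity of the two laws of one observed interval. Half of the null
mass of the likelihood ratio L lies at or above the median γ, so Markov applied to √L under the null
gives √γ ≤ 2 h^b. Markov applied to 1/√L under the alternative bounds the probability q that L ≤ γ
by √γ h^b, hence q ≤ 2 h^(2b) (`stageLaw_univ_le_threshold`). Gaussian determinants give h^4 ≤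
(1+x)/(1+x/2)^2 with x = (k-1)ρ. This is of order 1/x for large x and at most exp(-x^2/9) for x ≤ 1,
which produces the two regimes. Each makes q of order at most (log(n/k))^(-3/2), and this beats the
union bound over the K = O(log N) steps.

Early stopping: a clean interval is present at no more than 2 of the stages 0, …, K in expectation,
and distinct intervals are independent. Chebyshev then bounds the probability that the total exceeds
4N by (K+1)^2/N (`measure_sum_stageCount_gt_le`).

The budget is deterministic. The remaining work is to show that the adaptive procedure, which sees
only the queried coordinates, acts as if it saw everything until it stops (`query_history`), and
that the blocks of observations have the expected product law (`IsBlockSet.map_stages`). -/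

lemma gaussianDensity_pos {k : ℕ} {V : Matrix (Fin k) (Fin k) ℝ} (hV : 0 < V.det)
    (z : EuclideanSpace ℝ (Fin k)) : 0 < gaussianDensity V z := by
  unfold gaussianDensity
  have : 0 < (2 * Real.pi) ^ k * V.det := by positivity
  positivity

lemma continuous_gaussianDensity {k : ℕ} (V : Matrix (Fin k) (Fin k) ℝ) :
    Continuous (gaussianDensity V) := by
  unfold gaussianDensity
  have h1 : Continuous fun z : EuclideanSpace ℝ (Fin k) => z.ofLp :=
    PiLp.continuous_ofLp 2 _
  have h2 : Continuous fun z : EuclideanSpace ℝ (Fin k) => V⁻¹.mulVec z.ofLp :=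
    continuous_const.matrix_mulVec h1
  exact continuous_const.mul (Real.continuous_exp.comp (continuous_const.mul (h1.dotProduct h2)))

lemma gaussianDensity_one {k : ℕ} (z : EuclideanSpace ℝ (Fin k)) :
    gaussianDensity (1 : Matrix (Fin k) (Fin k) ℝ) z =
      (Real.sqrt ((2 * Real.pi) ^ k))⁻¹ * Real.exp (-(1 / 2) * ‖z‖ ^ 2) := by
  have : dotProduct z.ofLp z.ofLp = ‖z‖ ^ 2 := by
    rw [EuclideanSpace.real_norm_sq_eq]
    simp [dotProduct, sq]
  simp [gaussianDensity, this]

lemma integrable_gaussianDensity_one {k : ℕ} :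
    Integrable (gaussianDensity (1 : Matrix (Fin k) (Fin k) ℝ)) := by
  have h := (GaussianFourier.integrable_cexp_neg_mul_sq_norm_add (b := (1 / 2 : ℂ)) (by norm_num) 0
    (0 : EuclideanSpace ℝ (Fin k))).re
  have h2 : (fun v : EuclideanSpace ℝ (Fin k) =>
      RCLike.re (Complex.exp (-(1 / 2 : ℂ) * (‖v‖ : ℂ) ^ 2 + 0 * (inner ℝ 0 v : ℝ)))) =
      fun v => Real.exp (-(1 / 2) * ‖v‖ ^ 2) := by
    funext v
    have : (-(1 / 2 : ℂ) * (‖v‖ : ℂ) ^ 2 + 0 * (inner ℝ 0 v : ℝ)) =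
        ((-(1 / 2) * ‖v‖ ^ 2 : ℝ) : ℂ) := by push_cast; ring
    rw [this, ← Complex.ofReal_exp]
    exact Complex.ofReal_re _
  rw [h2] at h
  have h3 := h.const_mul (Real.sqrt ((2 * Real.pi) ^ k))⁻¹
  exact h3.congr (Eventually.of_forall fun z => (gaussianDensity_one z).symm)

/-- Both sides are finite measures, so it is enough to compare characteristic functions; that of the
density is a Gaussian Fourier integral. -/
lemma stdGaussian_eq_withDensity (k : ℕ) :
    stdGaussian (EuclideanSpace ℝ (Fin k)) = volume.withDensity fun z =>
      ENNReal.ofReal (gaussianDensity (1 : Matrix (Fin k) (Fin k) ℝ) z) := by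
  have hfin : IsFiniteMeasure ((volume : Measure (EuclideanSpace ℝ (Fin k))).withDensity fun z =>
      ENNReal.ofReal (gaussianDensity (1 : Matrix (Fin k) (Fin k) ℝ) z)) :=
    isFiniteMeasure_withDensity_ofReal integrable_gaussianDensity_one.2
  refine Measure.ext_of_charFun (funext fun t => ?_)
  rw [charFun_stdGaussian, charFun_apply]
  have hm : Measurable fun z : EuclideanSpace ℝ (Fin k) =>
      (gaussianDensity (1 : Matrix (Fin k) (Fin k) ℝ) z).toNNReal :=
    (continuous_gaussianDensity _).measurable.real_toNNReal
  have : (fun z => ENNReal.ofReal (gaussianDensity (1 : Matrix (Fin k) (Fin k) ℝ) z)) =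
      fun z => ((gaussianDensity (1 : Matrix (Fin k) (Fin k) ℝ) z).toNNReal : ℝ≥0∞) := rfl
  rw [this, integral_withDensity_eq_integral_smul hm]
  have hI := GaussianFourier.integral_cexp_neg_mul_sq_norm_add (b := (1 / 2 : ℂ)) (by norm_num)
    Complex.I t
  have hc : (Real.sqrt ((2 * Real.pi) ^ k) : ℂ) =
      (Real.pi / (1 / 2 : ℂ)) ^ (Module.finrank ℝ (EuclideanSpace ℝ (Fin k)) / 2 : ℂ) := by
    have h1 : (Real.pi / (1 / 2 : ℂ)) = ((2 * Real.pi : ℝ) : ℂ) := by push_cast; ring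
    rw [h1, finrank_euclideanSpace_fin]
    have h2 : ((k : ℂ) / 2) = (((k : ℝ) / 2 : ℝ) : ℂ) := by push_cast; ring
    rw [h2, ← Complex.ofReal_cpow (by positivity), Real.sqrt_eq_rpow, ← Real.rpow_natCast,
      ← Real.rpow_mul (by positivity)]
    congr 2
    ring
  rw [← hc] at hI
  have hne : (Real.sqrt ((2 * Real.pi) ^ k) : ℂ) ≠ 0 := by
    have : 0 < Real.sqrt ((2 * Real.pi) ^ k) := by positivity
    exact_mod_cast this.ne'
  calc Complex.exp (-(‖t‖ : ℂ) ^ 2 / 2)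
      = (Real.sqrt ((2 * Real.pi) ^ k) : ℂ)⁻¹ * ∫ v : EuclideanSpace ℝ (Fin k),
          Complex.exp (-(1 / 2 : ℂ) * (‖v‖ : ℂ) ^ 2 + Complex.I * (inner ℝ t v : ℝ)) := by
        rw [hI, ← mul_assoc, inv_mul_cancel₀ hne, one_mul]
        congr 1
        rw [Complex.I_sq]
        ring
    _ = _ := by
        rw [← integral_const_mul]
        refine integral_congr_ae (Eventually.of_forall fun v => ?_)
        have hnn : 0 ≤ gaussianDensity (1 : Matrix (Fin k) (Fin k) ℝ) v :=
          (gaussianDensity_pos (by simp) v).le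
        simp only
        rw [NNReal.smul_def, Real.coe_toNNReal _ hnn, gaussianDensity_one, Complex.real_smul,
          Complex.exp_add, real_inner_comm]
        push_cast
        rw [mul_assoc, mul_comm Complex.I]

lemma gaussianDensity_map {k : ℕ} {V B : Matrix (Fin k) (Fin k) ℝ} (hB : B.IsHermitian)
    (hBB : B * B = V) (hV : 0 < V.det) (z : EuclideanSpace ℝ (Fin k)) :
    gaussianDensity V (Matrix.toEuclideanCLM (𝕜 := ℝ) B z) =
      |B.det|⁻¹ * gaussianDensity (1 : Matrix (Fin k) (Fin k) ℝ) z := by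
  have hdet : V.det = B.det ^ 2 := by rw [← hBB, Matrix.det_mul, sq]
  have hBu : IsUnit B.det := by
    rw [isUnit_iff_ne_zero]
    rintro h
    rw [hdet, h] at hV
    norm_num at hV
  have hBT : B.transpose = B := by simpa [Matrix.IsHermitian] using hB
  have hq : dotProduct (B.mulVec z.ofLp) (V⁻¹.mulVec (B.mulVec z.ofLp)) =
      dotProduct z.ofLp z.ofLp := by
    have h1 : V⁻¹.mulVec (B.mulVec z.ofLp) = B⁻¹.mulVec z.ofLp := by
      rw [Matrix.mulVec_mulVec, ← hBB, Matrix.mul_inv_rev, Matrix.mul_assoc,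
        Matrix.nonsing_inv_mul _ hBu, Matrix.mul_one]
    rw [h1, ← Matrix.vecMul_transpose, hBT, ← Matrix.dotProduct_mulVec, Matrix.mulVec_mulVec,
      Matrix.mul_nonsing_inv _ hBu, Matrix.one_mulVec]
  have hs : Real.sqrt ((2 * Real.pi) ^ k * V.det) = Real.sqrt ((2 * Real.pi) ^ k) * |B.det| := by
    rw [Real.sqrt_mul (by positivity), hdet, Real.sqrt_sq_eq_abs]
  simp only [gaussianDensity, Matrix.ofLp_toEuclideanCLM, hq, hs, inv_one, Matrix.one_mulVec,
    Matrix.det_one, mul_one]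
  rw [mul_inv]
  ring

-- The law is the image of the standard Gaussian under the positive square root B of V, so this is
-- the linear change of variables z ↦ Bz, with Jacobian |det B|.
open scoped MatrixOrder Matrix.Norms.L2Operator in
lemma multivariateGaussian_eq_withDensity {k : ℕ} {V : Matrix (Fin k) (Fin k) ℝ} (hV : V.PosDef) :
    multivariateGaussian 0 V = volume.withDensity fun z =>
      ENNReal.ofReal (gaussianDensity V z) := by
  have hnn : 0 ≤ V := hV.posSemidef.nonneg
  set B := CFC.sqrt V with hBdef
  have hBB : B * B = V := CFC.sqrt_mul_sqrt_self V hnn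
  have hB : B.IsHermitian := (Matrix.nonneg_iff_posSemidef.1 (CFC.sqrt_nonneg V)).isHermitian
  have hdet : V.det = B.det ^ 2 := by rw [← hBB, Matrix.det_mul, sq]
  have hB0 : B.det ≠ 0 := by
    intro h
    have := hV.det_pos
    rw [hdet, h] at this
    norm_num at this
  set T : EuclideanSpace ℝ (Fin k) →L[ℝ] EuclideanSpace ℝ (Fin k) :=
    Matrix.toEuclideanCLM (𝕜 := ℝ) B with hT
  have hTdet : LinearMap.det (T : EuclideanSpace ℝ (Fin k) →ₗ[ℝ] EuclideanSpace ℝ (Fin k)) =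
      B.det := by
    rw [hT, Matrix.coe_toEuclideanCLM_eq_toEuclideanLin, Matrix.toEuclideanLin_eq_toLin_orthonormal,
      LinearMap.det_toLin]
  have hmap : Measure.map T (volume : Measure (EuclideanSpace ℝ (Fin k))) =
      ENNReal.ofReal |(B.det)⁻¹| • volume := by
    have := Measure.map_linearMap_addHaar_eq_smul_addHaar
      (volume : Measure (EuclideanSpace ℝ (Fin k))) (f := T) (by rw [hTdet]; exact hB0)
    rw [hTdet] at this
    exact this
  have hgm : Measurable fun z : EuclideanSpace ℝ (Fin k) => ENNReal.ofReal (gaussianDensity V z) :=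
    (continuous_gaussianDensity V).measurable.ennreal_ofReal
  have hTm : Measurable T := T.continuous.measurable
  rw [multivariateGaussian, ← hBdef, stdGaussian_eq_withDensity]
  simp only [zero_add, ← hT]
  ext s hs
  have hpos : 0 < |B.det| := abs_pos.2 hB0
  rw [Measure.map_apply hTm hs, withDensity_apply _ (hTm hs), withDensity_apply _ hs]
  have hvol : (volume : Measure (EuclideanSpace ℝ (Fin k))) =
      ENNReal.ofReal |B.det| • Measure.map T volume := by
    rw [hmap, smul_smul, ← ENNReal.ofReal_mul hpos.le, abs_inv, mul_inv_cancel₀ hpos.ne',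
      ENNReal.ofReal_one, one_smul]
  conv_rhs => rw [hvol]
  rw [Measure.restrict_smul, lintegral_smul_measure, setLIntegral_map hs hgm hTm, smul_eq_mul,
    ← lintegral_const_mul _ (f := fun z => ENNReal.ofReal (gaussianDensity V (T z)))
      (hgm.comp hTm)]
  refine lintegral_congr fun z => ?_
  rw [hT, gaussianDensity_map hB hBB hV.det_pos, ENNReal.ofReal_mul (by positivity), ← mul_assoc,
    ← ENNReal.ofReal_mul hpos.le, mul_inv_cancel₀ hpos.ne', ENNReal.ofReal_one, one_mul]

lemma lintegral_gaussianDensity {k : ℕ} {V : Matrix (Fin k) (Fin k) ℝ} (hV : V.PosDef) :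
    ∫⁻ z, ENNReal.ofReal (gaussianDensity V z) = 1 := by
  have h : multivariateGaussian 0 V Set.univ = 1 := measure_univ
  rwa [multivariateGaussian_eq_withDensity hV, withDensity_apply _ MeasurableSet.univ,
    Measure.restrict_univ] at h

/-! ### The matrices `Σ_S` -/

lemma corrMatrix_empty {ι : Type*} [DecidableEq ι] (ρ : ℝ) : corrMatrix (∅ : Finset ι) ρ = 1 := by
  ext i j
  simp [corrMatrix, Matrix.one_apply]

lemma corrMatrix_eq {ι : Type*} [Fintype ι] [DecidableEq ι] (S : Finset ι) (ρ : ℝ) :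
    corrMatrix S ρ = Matrix.diagonal (fun i => if i ∈ S then 1 - ρ else 1) +
      ρ • Matrix.vecMulVec (fun i => if i ∈ S then 1 else 0)
        (star fun i => if i ∈ S then 1 else 0) := by
  ext i j
  by_cases hij : i = j
  · subst hij
    by_cases hi : i ∈ S <;> simp [corrMatrix, Matrix.vecMulVec_apply, hi]
  · by_cases hi : i ∈ S <;> by_cases hj : j ∈ S <;>
      simp [corrMatrix, Matrix.vecMulVec_apply, hij, hi, hj]

lemma posDef_corrMatrix {ι : Type*} [Fintype ι] [DecidableEq ι] (S : Finset ι) {ρ : ℝ}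
    (h0 : 0 ≤ ρ) (h1 : ρ < 1) : (corrMatrix S ρ).PosDef := by
  rw [corrMatrix_eq]
  refine Matrix.PosDef.add_posSemidef ?_ ?_
  · refine Matrix.PosDef.diagonal fun i => ?_
    split_ifs <;> linarith
  · exact (Matrix.posSemidef_vecMulVec_self_star _).smul h0

/-- The matrix is a rank-one perturbation of (1 - ρ) times the identity, so the matrix determinant
lemma applies. -/
lemma det_corrMatrix_univ {k : ℕ} (hk : 1 ≤ k) {ρ : ℝ} (h1 : ρ < 1) :
    (corrMatrix (Finset.univ : Finset (Fin k)) ρ).det =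
      (1 - ρ) ^ (k - 1) * (1 + ((k : ℝ) - 1) * ρ) := by
  have hne : 1 - ρ ≠ 0 := by linarith
  have h : corrMatrix (Finset.univ : Finset (Fin k)) ρ = (1 - ρ) •
      (1 + Matrix.replicateCol Unit (fun _ : Fin k => ρ / (1 - ρ)) *
        Matrix.replicateRow Unit (fun _ : Fin k => (1 : ℝ))) := by
    ext i j
    by_cases hij : i = j
    · subst hij
      simp [corrMatrix, Matrix.mul_apply]
      field_simp
      ring
    · simp [corrMatrix, Matrix.mul_apply, hij]
      field_simp
  rw [h, Matrix.det_smul, Matrix.det_one_add_replicateCol_mul_replicateRow]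
  obtain ⟨m, rfl⟩ : ∃ m, k = m + 1 := ⟨k - 1, by omega⟩
  simp [dotProduct]
  field_simp
  ring

lemma half_one_add_corrMatrix {ι : Type*} [DecidableEq ι] (S : Finset ι) (ρ : ℝ) :
    (1 / 2 : ℝ) • (1 + corrMatrix S ρ) = corrMatrix S (ρ / 2) := by
  ext i j
  by_cases hij : i = j
  · simp [corrMatrix, hij]; norm_num
  · by_cases h : i ∈ S ∧ j ∈ S <;> simp [corrMatrix, hij, h]
    ring

/-! ### The Hellinger affinity -/

/-- The Hellinger affinity of the standard Gaussian law and the centred Gaussian law with covariance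
matrix `V`. -/
def affinity {k : ℕ} (V : Matrix (Fin k) (Fin k) ℝ) : ℝ≥0∞ :=
  ∫⁻ z, ENNReal.ofReal (Real.sqrt (gaussianDensity (1 : Matrix (Fin k) (Fin k) ℝ) z *
    gaussianDensity V z))

/-- The geometric mean of two centred Gaussian densities is a multiple of a third one, whose
precision matrix is the average of the two. The affinity is that multiple, a ratio of normalizing
constants; its fourth power is free of radicals. -/
lemma affinity_pow_four {k : ℕ} {V : Matrix (Fin k) (Fin k) ℝ} (hV : V.PosDef) :
    ∃ h : ℝ, 0 ≤ h ∧ affinity V = ENNReal.ofReal h ∧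
      h ^ 4 = V.det / ((1 / 2 : ℝ) • (1 + V)).det ^ 2 := by
  have hd := hV.det_pos
  set U : Matrix (Fin k) (Fin k) ℝ := (1 / 2 : ℝ) • (1 + V⁻¹) with hU
  have hUpos : U.PosDef := (Matrix.PosDef.one.add hV.inv).smul (by norm_num)
  have hW : U⁻¹.PosDef := hUpos.inv
  have hWd := hW.det_pos
  have hUd := hUpos.det_pos
  have hWinv : (U⁻¹)⁻¹ = U := Matrix.nonsing_inv_nonsing_inv _ (isUnit_iff_ne_zero.2 hUd.ne')
  have hdetW : U⁻¹.det = U.det⁻¹ := by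
    rw [Matrix.det_nonsing_inv, Ring.inverse_eq_inv']
  have hdetU : U.det * V.det = ((1 / 2 : ℝ) • (1 + V)).det := by
    rw [← Matrix.det_mul, hU, Matrix.smul_mul, add_mul, Matrix.one_mul,
      Matrix.nonsing_inv_mul _ (isUnit_iff_ne_zero.2 hd.ne'), add_comm]
  set p : ℝ := (2 * Real.pi) ^ k with hp
  have hppos : 0 < p := by positivity
  set c₀ : ℝ := (Real.sqrt p)⁻¹
  set c₁ : ℝ := (Real.sqrt (p * V.det))⁻¹
  set c₂ : ℝ := (Real.sqrt (p * U⁻¹.det))⁻¹ with hc2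
  have hc0 : 0 < c₀ := by positivity
  have hc1 : 0 < c₁ := by positivity
  have hc2p : 0 < c₂ := by positivity
  have key : ∀ z : EuclideanSpace ℝ (Fin k),
      Real.sqrt (gaussianDensity (1 : Matrix (Fin k) (Fin k) ℝ) z * gaussianDensity V z) =
        Real.sqrt (c₀ * c₁) / c₂ * gaussianDensity U⁻¹ z := by
    intro z
    have e : dotProduct z.ofLp (U.mulVec z.ofLp) = (1 / 2) *
        (dotProduct z.ofLp z.ofLp + dotProduct z.ofLp (V⁻¹.mulVec z.ofLp)) := by
      rw [hU, Matrix.smul_mulVec, Matrix.add_mulVec, dotProduct_smul, dotProduct_add,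
        Matrix.one_mulVec, smul_eq_mul]
    have h1 : gaussianDensity (1 : Matrix (Fin k) (Fin k) ℝ) z * gaussianDensity V z =
        (c₀ * c₁) * (Real.exp (-(1 / 2) * dotProduct z.ofLp (U.mulVec z.ofLp))) ^ 2 := by
      rw [← Real.exp_nat_mul, e]
      simp only [gaussianDensity, Matrix.det_one, mul_one, inv_one, Matrix.one_mulVec]
      rw [mul_mul_mul_comm, ← Real.exp_add]
      congr 2
      push_cast
      ring
    rw [h1, Real.sqrt_mul (by positivity), Real.sqrt_sq (Real.exp_pos _).le, gaussianDensity,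
      hWinv, ← hp, ← hc2]
    field_simp
  refine ⟨Real.sqrt (c₀ * c₁) / c₂, by positivity, ?_, ?_⟩
  · unfold affinity
    simp_rw [key]
    have : ∀ z : EuclideanSpace ℝ (Fin k),
        ENNReal.ofReal (Real.sqrt (c₀ * c₁) / c₂ * gaussianDensity U⁻¹ z) =
        ENNReal.ofReal (Real.sqrt (c₀ * c₁) / c₂) * ENNReal.ofReal (gaussianDensity U⁻¹ z) :=
      fun z => ENNReal.ofReal_mul (by positivity)
    simp_rw [this]
    rw [lintegral_const_mul _ (continuous_gaussianDensity _).measurable.ennreal_ofReal,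
      lintegral_gaussianDensity hW, mul_one]
  · have s0 : c₀ ^ 2 = p⁻¹ := by rw [inv_pow, Real.sq_sqrt hppos.le]
    have s1 : c₁ ^ 2 = (p * V.det)⁻¹ := by rw [inv_pow, Real.sq_sqrt (by positivity)]
    have s2 : c₂ ^ 2 = (p * U⁻¹.det)⁻¹ := by rw [inv_pow, Real.sq_sqrt (by positivity)]
    have s3 : Real.sqrt (c₀ * c₁) ^ 2 = c₀ * c₁ := Real.sq_sqrt (by positivity)
    have : (Real.sqrt (c₀ * c₁) / c₂) ^ 4 =
        c₀ ^ 2 * c₁ ^ 2 / (c₂ ^ 2) ^ 2 := by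
      rw [div_pow, ← pow_mul, show (4 : ℕ) = 2 * 2 from rfl, pow_mul, s3, mul_pow]
    rw [this, s0, s1, s2, hdetW, ← hdetU]
    field_simp

lemma affinity_corrMatrix_le {k : ℕ} (hk : 1 ≤ k) {ρ : ℝ} (h0 : 0 < ρ) (h1 : ρ < 1) :
    ∃ h : ℝ, 0 ≤ h ∧ affinity (corrMatrix (Finset.univ : Finset (Fin k)) ρ) = ENNReal.ofReal h ∧
      h ^ 4 ≤ (1 + ((k : ℝ) - 1) * ρ) / (1 + ((k : ℝ) - 1) * ρ / 2) ^ 2 := by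
  obtain ⟨h, hh, hA, h4⟩ := affinity_pow_four
    (posDef_corrMatrix (Finset.univ : Finset (Fin k)) h0.le h1)
  refine ⟨h, hh, hA, ?_⟩
  have hk' : (0 : ℝ) ≤ (k : ℝ) - 1 := by
    have : (1 : ℝ) ≤ k := by exact_mod_cast hk
    linarith
  have hx : 0 ≤ ((k : ℝ) - 1) * ρ := by positivity
  rw [h4, half_one_add_corrMatrix, det_corrMatrix_univ hk h1, det_corrMatrix_univ hk (by linarith),
    mul_pow, ← mul_div_assoc, mul_div_mul_comm]
  -- The eigenvalue 1 - ρ, of multiplicity k - 1, only lowers the affinity, since 1 - ρ ≤ (1 -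
  -- ρ/2)^2; its contribution is dropped.
  have hle : (1 - ρ) ^ (k - 1) / ((1 - ρ / 2) ^ (k - 1)) ^ 2 ≤ 1 := by
    have hpos : 0 < 1 - ρ / 2 := by linarith
    rw [div_le_one (by positivity), ← pow_mul, mul_comm, pow_mul]
    refine pow_le_pow_left₀ (by linarith) ?_ _
    nlinarith [sq_nonneg ρ]
  have hn : 0 ≤ (1 + ((k : ℝ) - 1) * ρ) / (1 + ((k : ℝ) - 1) * ρ / 2) ^ 2 := by positivity
  calc _ ≤ 1 * ((1 + ((k : ℝ) - 1) * ρ) / (1 + ((k : ℝ) - 1) * ρ / 2) ^ 2) :=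
        mul_le_mul_of_nonneg_right hle hn
    _ = _ := one_mul _

/-! ### Medians -/

lemma exists_measure_Iic_lt {μ : Measure ℝ} [IsProbabilityMeasure μ] :
    ∃ a : ℝ, μ (Set.Iic a) < 1 / 2 := by
  obtain ⟨a, ha⟩ := ((tendsto_cdf_atBot μ).eventually (gt_mem_nhds one_half_pos)).exists
  refine ⟨a, ?_⟩
  rw [← ofReal_cdf, ENNReal.ofReal_lt_iff_lt_toReal (cdf_nonneg μ a) (by simp)]
  simpa using ha

lemma exists_le_measure_Iic {μ : Measure ℝ} [IsProbabilityMeasure μ] :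
    ∃ a : ℝ, 1 / 2 ≤ μ (Set.Iic a) := by
  have h := tendsto_measure_Iic_atTop μ
  rw [measure_univ] at h
  obtain ⟨a, ha⟩ := (h.eventually (lt_mem_nhds (b := 1) (a := 1 / 2)
    (by simp))).exists
  exact ⟨a, ha.le⟩

lemma measure_Iic_lt_of_lt_median {μ : Measure ℝ} [IsProbabilityMeasure μ] {x : ℝ}
    (hx : x < median μ) : μ (Set.Iic x) < 1 / 2 := by
  by_contra h
  obtain ⟨a, ha⟩ := exists_measure_Iic_lt (μ := μ)
  have hbdd : BddBelow {x : ℝ | 1 / 2 ≤ μ (Set.Iic x)} := by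
    refine ⟨a, fun y hy => ?_⟩
    by_contra hlt
    exact absurd (hy.trans (measure_mono (Set.Iic_subset_Iic.2 (not_le.1 hlt).le))) (not_le.2 ha)
  exact absurd (csInf_le hbdd (not_lt.1 h)) (not_le.2 hx)

/-- Right continuity of the distribution function shows that the infimum is attained. No continuity
of the law is assumed, so an atom at the median is allowed; hence the separate bounds below for the
strict and the weak upper tail. -/
lemma half_le_measure_Iic_median (μ : Measure ℝ) [IsProbabilityMeasure μ] :
    1 / 2 ≤ μ (Set.Iic (median μ)) := by
  have hlim : Tendsto (fun x => μ (Set.Iic x)) (𝓝[>] median μ) (𝓝 (μ (Set.Iic (median μ)))) := by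
    have h := tendsto_measure_biInter_gt (μ := μ) (s := fun x : ℝ => Set.Iic x) (a := median μ)
      (fun r _ => measurableSet_Iic.nullMeasurableSet)
      (fun i j _ hij => Set.Iic_subset_Iic.2 hij)
      ⟨median μ + 1, by linarith, measure_ne_top _ _⟩
    have : ⋂ r, ⋂ (_ : r > median μ), Set.Iic r = Set.Iic (median μ) := by
      ext y
      simp only [Set.mem_iInter, Set.mem_Iic]
      exact ⟨fun h => le_of_forall_gt_imp_ge_of_dense h, fun h r hr => h.trans hr.le⟩
    rwa [this] at h
  refine ge_of_tendsto hlim ?_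
  filter_upwards [self_mem_nhdsWithin] with x hx
  obtain ⟨y, hy, hyx⟩ := exists_lt_of_csInf_lt (exists_le_measure_Iic (μ := μ)) hx
  exact le_trans hy (measure_mono (Set.Iic_subset_Iic.2 hyx.le))

lemma measure_Iio_median_le (μ : Measure ℝ) [IsProbabilityMeasure μ] :
    μ (Set.Iio (median μ)) ≤ 1 / 2 := by
  obtain ⟨u, hmu, hu, hlim⟩ := exists_seq_strictMono_tendsto (median μ)
  have hU : ⋃ n, Set.Iic (u n) = Set.Iio (median μ) := by
    ext y
    simp only [Set.mem_iUnion, Set.mem_Iic, Set.mem_Iio]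
    constructor
    · rintro ⟨i, hi⟩
      exact hi.trans_lt (hu i)
    · intro hy
      obtain ⟨i, hi⟩ := (hlim.eventually (lt_mem_nhds hy)).exists
      exact ⟨i, hi.le⟩
  rw [← hU]
  have hmono : Monotone fun n => Set.Iic (u n) := by
    intro i j hij
    exact Set.Iic_subset_Iic.2 (hmu.monotone hij)
  rw [hmono.measure_iUnion]
  exact iSup_le fun i => (measure_Iic_lt_of_lt_median (hu i)).le

lemma measure_Ioi_median_le (μ : Measure ℝ) [IsProbabilityMeasure μ] :
    μ (Set.Ioi (median μ)) ≤ 1 / 2 := by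
  rw [← Set.compl_Iic, prob_compl_eq_one_sub measurableSet_Iic]
  calc 1 - μ (Set.Iic (median μ)) ≤ 1 - 1 / 2 := tsub_le_tsub_left (half_le_measure_Iic_median μ) 1
    _ = 1 / 2 := by simp

lemma half_le_measure_Ici_median (μ : Measure ℝ) [IsProbabilityMeasure μ] :
    1 / 2 ≤ μ (Set.Ici (median μ)) := by
  rw [← Set.compl_Iio, prob_compl_eq_one_sub measurableSet_Iio]
  calc (1 / 2 : ℝ≥0∞) = 1 - 1 / 2 := by simp
    _ ≤ _ := tsub_le_tsub_left (measure_Iio_median_le μ) 1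

/-! ### The likelihood ratio test at the median -/

/-- The law of `b` independent observations of one interval of length `k`, contaminated if
`T = univ` and uncontaminated if `T = ∅`. -/
def stageLaw (k : ℕ) (T : Finset (Fin k)) (ρ : ℝ) (b : ℕ) :
    Measure (Fin b → EuclideanSpace ℝ (Fin k)) :=
  Measure.pi fun _ => sampleLaw T ρ

instance {ι : Type*} [Fintype ι] [DecidableEq ι] (S : Finset ι) (ρ : ℝ) :
    IsProbabilityMeasure (sampleLaw S ρ) := by
  unfold sampleLaw
  infer_instance

instance (k : ℕ) (T : Finset (Fin k)) (ρ : ℝ) (b : ℕ) :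
    IsProbabilityMeasure (stageLaw k T ρ b) := by
  unfold stageLaw
  infer_instance

lemma measurable_likelihoodRatio {k b : ℕ} (ρ : ℝ) :
    Measurable (likelihoodRatio (k := k) (b := b) ρ) := by
  unfold likelihoodRatio
  have h : ∀ V : Matrix (Fin k) (Fin k) ℝ, Measurable
      fun z : Fin b → EuclideanSpace ℝ (Fin k) => ∏ t, gaussianDensity V (z t) := fun V =>
    Finset.measurable_prod _ fun t _ =>
      (continuous_gaussianDensity V).measurable.comp (measurable_pi_apply t)
  exact (h _).div (h _)

lemma lintegral_pi_prod {E : Type*} [MeasurableSpace E] {μ : Measure E} [IsProbabilityMeasure μ]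
    {f : E → ℝ≥0∞} (hf : Measurable f) (b : ℕ) :
    ∫⁻ z : Fin b → E, ∏ t, f (z t) ∂(Measure.pi fun _ => μ) = (∫⁻ x, f x ∂μ) ^ b := by
  rw [lintegral_prod_eq_prod_lintegral_of_indepFun Finset.univ
    (fun (t : Fin b) (z : Fin b → E) => f (z t))
    (iIndepFun_pi (X := fun _ : Fin b => f) fun _ => hf.aemeasurable)
    fun t => hf.comp (measurable_pi_apply t)]
  have : ∀ t : Fin b, ∫⁻ z : Fin b → E, f (z t) ∂(Measure.pi fun _ => μ) = ∫⁻ x, f x ∂μ :=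
    fun t => (measurePreserving_eval (fun _ : Fin b => μ) t).lintegral_comp hf
  simp [this]

lemma threshold_eq (k : ℕ) (ρ : ℝ) (b : ℕ) :
    threshold k ρ b = median ((stageLaw k ∅ ρ b).map (likelihoodRatio ρ)) := rfl

lemma stageLaw_empty_threshold_lt (k : ℕ) (ρ : ℝ) (b : ℕ) :
    stageLaw k ∅ ρ b {z | threshold k ρ b < likelihoodRatio ρ z} ≤ 1 / 2 := by
  have := Measure.isProbabilityMeasure_map (μ := stageLaw k ∅ ρ b)
    (measurable_likelihoodRatio ρ).aemeasurable
  have h := measure_Ioi_median_le ((stageLaw k ∅ ρ b).map (likelihoodRatio ρ))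
  rwa [Measure.map_apply (measurable_likelihoodRatio ρ) measurableSet_Ioi] at h

lemma half_le_stageLaw_empty_threshold_le (k : ℕ) (ρ : ℝ) (b : ℕ) :
    1 / 2 ≤ stageLaw k ∅ ρ b {z | threshold k ρ b ≤ likelihoodRatio ρ z} := by
  have := Measure.isProbabilityMeasure_map (μ := stageLaw k ∅ ρ b)
    (measurable_likelihoodRatio ρ).aemeasurable
  have h := half_le_measure_Ici_median ((stageLaw k ∅ ρ b).map (likelihoodRatio ρ))
  rwa [Measure.map_apply (measurable_likelihoodRatio ρ) measurableSet_Ici] at h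

lemma lintegral_sampleLaw {k : ℕ} {T : Finset (Fin k)} {ρ : ℝ} (h0 : 0 < ρ) (h1 : ρ < 1)
    {f : EuclideanSpace ℝ (Fin k) → ℝ≥0∞} (hf : Measurable f) :
    ∫⁻ z, f z ∂(sampleLaw T ρ) =
      ∫⁻ z, ENNReal.ofReal (gaussianDensity (corrMatrix T ρ) z) * f z := by
  rw [sampleLaw, multivariateGaussian_eq_withDensity (posDef_corrMatrix T h0.le h1),
    lintegral_withDensity_eq_lintegral_mul _
      (continuous_gaussianDensity _).measurable.ennreal_ofReal hf]
  rfl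

lemma lintegral_sqrt_density_ratio {k : ℕ} {T T' : Finset (Fin k)} {ρ : ℝ} (h0 : 0 < ρ)
    (h1 : ρ < 1) :
    ∫⁻ z, ENNReal.ofReal (Real.sqrt (gaussianDensity (corrMatrix T' ρ) z /
        gaussianDensity (corrMatrix T ρ) z)) ∂(sampleLaw T ρ) =
      ∫⁻ z, ENNReal.ofReal (Real.sqrt (gaussianDensity (corrMatrix T ρ) z *
        gaussianDensity (corrMatrix T' ρ) z)) := by
  have hm : Measurable fun z => ENNReal.ofReal (Real.sqrt (gaussianDensity (corrMatrix T' ρ) z /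
      gaussianDensity (corrMatrix T ρ) z)) :=
    ((continuous_gaussianDensity _).measurable.div
      (continuous_gaussianDensity _).measurable).sqrt.ennreal_ofReal
  rw [lintegral_sampleLaw h0 h1 hm]
  refine lintegral_congr fun z => ?_
  have hp := gaussianDensity_pos (posDef_corrMatrix T h0.le h1).det_pos z
  have hp' := gaussianDensity_pos (posDef_corrMatrix T' h0.le h1).det_pos z
  rw [← ENNReal.ofReal_mul hp.le]
  congr 1
  rw [eq_comm, Real.sqrt_eq_iff_mul_self_eq (by positivity) (by positivity), mul_mul_mul_comm,
    Real.mul_self_sqrt (by positivity)]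
  field_simp

/-- Affinities of product laws multiply. Keeping T and T' arbitrary serves both √L under the null
and 1/√L under the alternative. -/
lemma lintegral_sqrt_likelihood {k b : ℕ} {T T' : Finset (Fin k)} {ρ : ℝ} (h0 : 0 < ρ)
    (h1 : ρ < 1) :
    ∫⁻ z, ENNReal.ofReal (Real.sqrt ((∏ t, gaussianDensity (corrMatrix T' ρ) (z t)) /
        ∏ t, gaussianDensity (corrMatrix T ρ) (z t))) ∂(stageLaw k T ρ b) =
      (∫⁻ z, ENNReal.ofReal (Real.sqrt (gaussianDensity (corrMatrix T ρ) z *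
        gaussianDensity (corrMatrix T' ρ) z))) ^ b := by
  have hm : Measurable fun z => ENNReal.ofReal (Real.sqrt (gaussianDensity (corrMatrix T' ρ) z /
      gaussianDensity (corrMatrix T ρ) z)) :=
    ((continuous_gaussianDensity _).measurable.div
      (continuous_gaussianDensity _).measurable).sqrt.ennreal_ofReal
  rw [← lintegral_sqrt_density_ratio h0 h1, stageLaw,
    ← lintegral_pi_prod hm]
  refine lintegral_congr fun z => ?_
  have hp := fun t => gaussianDensity_pos (posDef_corrMatrix T h0.le h1).det_pos (z t)
  have hp' := fun t => gaussianDensity_pos (posDef_corrMatrix T' h0.le h1).det_pos (z t)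
  rw [← ENNReal.ofReal_prod_of_nonneg fun t _ => Real.sqrt_nonneg _,
    ← Finset.prod_div_distrib, Real.sqrt_eq_rpow]
  congr 1
  rw [← Real.finsetProd_rpow _ _ fun t _ => (div_pos (hp' t) (hp t)).le]
  exact Finset.prod_congr rfl fun t _ => (Real.sqrt_eq_rpow _).symm

/-- Two applications of Markov's inequality, one under each law, eliminate the unknown median. The
result is squared so that h enters only through h^4. -/
lemma stageLaw_univ_le_threshold {k : ℕ} (hk : 1 ≤ k) {ρ : ℝ} (h0 : 0 < ρ) (h1 : ρ < 1) (b : ℕ) :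
    ((stageLaw k Finset.univ ρ b).real {z | likelihoodRatio ρ z ≤ threshold k ρ b}) ^ 2 ≤
      4 * ((1 + ((k : ℝ) - 1) * ρ) / (1 + ((k : ℝ) - 1) * ρ / 2) ^ 2) ^ b := by
  obtain ⟨h, hh, hA, h4⟩ := affinity_corrMatrix_le hk h0 h1
  set γ := threshold k ρ b with hγ
  have hLpos : ∀ z : Fin b → EuclideanSpace ℝ (Fin k), 0 < likelihoodRatio ρ z := fun z =>
    div_pos (Finset.prod_pos fun t _ => gaussianDensity_pos (posDef_corrMatrix _ h0.le h1).det_pos _)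
      (Finset.prod_pos fun t _ => gaussianDensity_pos (posDef_corrMatrix _ h0.le h1).det_pos _)
  have hLm := measurable_likelihoodRatio (k := k) (b := b) ρ
  -- The likelihood ratio is everywhere positive, so a nonpositive γ would leave no mass at or below
  -- it.
  have hγpos : 0 < γ := by
    have := Measure.isProbabilityMeasure_map (μ := stageLaw k ∅ ρ b) hLm.aemeasurable
    have h' := half_le_measure_Iic_median ((stageLaw k ∅ ρ b).map (likelihoodRatio ρ))
    rw [Measure.map_apply hLm measurableSet_Iic, ← threshold_eq] at h'
    by_contra hneg
    have : likelihoodRatio ρ ⁻¹' Set.Iic (threshold k ρ b) =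
        (∅ : Set (Fin b → EuclideanSpace ℝ (Fin k))) := by
      ext z
      simp only [Set.mem_preimage, Set.mem_Iic, Set.mem_empty_iff_false, iff_false, not_le]
      exact (not_lt.1 hneg).trans_lt (hLpos z)
    rw [this] at h'
    simp at h'
  have hA0 : ∫⁻ z, ENNReal.ofReal (Real.sqrt (likelihoodRatio ρ z)) ∂(stageLaw k ∅ ρ b) =
      ENNReal.ofReal (h ^ b) := by
    have := lintegral_sqrt_likelihood (b := b) (T := (∅ : Finset (Fin k))) (T' := Finset.univ) h0 h1
    rw [corrMatrix_empty] at this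
    rw [ENNReal.ofReal_pow hh, ← hA, affinity, ← this]
    simp only [likelihoodRatio, corrMatrix_empty]
  have hA1 : ∫⁻ z, ENNReal.ofReal (Real.sqrt (likelihoodRatio ρ z)⁻¹)
      ∂(stageLaw k Finset.univ ρ b) = ENNReal.ofReal (h ^ b) := by
    have := lintegral_sqrt_likelihood (b := b) (T := Finset.univ) (T' := (∅ : Finset (Fin k))) h0 h1
    rw [corrMatrix_empty] at this
    rw [ENNReal.ofReal_pow hh, ← hA, affinity]
    simp_rw [mul_comm (gaussianDensity 1 _)]
    rw [← this]
    simp only [likelihoodRatio, corrMatrix_empty, inv_div]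
  have hs : 0 < Real.sqrt γ := Real.sqrt_pos.2 hγpos
  have hhb : 0 ≤ h ^ b := pow_nonneg hh b
  have hγle : Real.sqrt γ ≤ 2 * h ^ b := by
    have hM := mul_meas_ge_le_lintegral (μ := stageLaw k ∅ ρ b)
      (hLm.sqrt.ennreal_ofReal) (ENNReal.ofReal (Real.sqrt γ))
    rw [hA0] at hM
    have hsub : {z | γ ≤ likelihoodRatio ρ z} ⊆ {z : Fin b → EuclideanSpace ℝ (Fin k) |
        ENNReal.ofReal (Real.sqrt γ) ≤ ENNReal.ofReal (Real.sqrt (likelihoodRatio ρ z))} :=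
      fun z hz => ENNReal.ofReal_le_ofReal (Real.sqrt_le_sqrt hz)
    have h2 : ENNReal.ofReal (Real.sqrt γ * (1 / 2)) ≤ ENNReal.ofReal (h ^ b) := by
      refine le_trans ?_ hM
      rw [ENNReal.ofReal_mul hs.le]
      gcongr
      refine le_trans ?_ ((half_le_stageLaw_empty_threshold_le k ρ b).trans (measure_mono hsub))
      rw [ENNReal.ofReal_div_of_pos two_pos]
      simp
    have := (ENNReal.ofReal_le_ofReal_iff hhb).1 h2
    linarith
  have hq : (stageLaw k Finset.univ ρ b).real {z | likelihoodRatio ρ z ≤ γ} ≤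
      Real.sqrt γ * h ^ b := by
    have hM := mul_meas_ge_le_lintegral (μ := stageLaw k Finset.univ ρ b)
      (hLm.inv.sqrt.ennreal_ofReal) (ENNReal.ofReal (Real.sqrt γ)⁻¹)
    have hA1' : ∫⁻ z, ENNReal.ofReal (Real.sqrt ((likelihoodRatio ρ)⁻¹ z))
      ∂(stageLaw k Finset.univ ρ b) = ENNReal.ofReal (h ^ b) := hA1
    rw [hA1'] at hM
    have hsub : {z | likelihoodRatio ρ z ≤ γ} ⊆ {z : Fin b → EuclideanSpace ℝ (Fin k) |
        ENNReal.ofReal (Real.sqrt γ)⁻¹ ≤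
          ENNReal.ofReal (Real.sqrt ((likelihoodRatio ρ)⁻¹ z))} := by
      intro z hz
      refine ENNReal.ofReal_le_ofReal ?_
      rw [← Real.sqrt_inv]
      exact Real.sqrt_le_sqrt (inv_anti₀ (hLpos z) hz)
    have h2 := (mul_le_mul_right (measure_mono hsub) (ENNReal.ofReal (Real.sqrt γ)⁻¹)).trans hM
    have h3 := ENNReal.toReal_mono ENNReal.ofReal_ne_top h2
    rw [ENNReal.toReal_mul, ENNReal.toReal_ofReal (by positivity), ENNReal.toReal_ofReal hhb,
      inv_mul_le_iff₀ hs] at h3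
    exact h3
  have hq0 : 0 ≤ (stageLaw k Finset.univ ρ b).real {z | likelihoodRatio ρ z ≤ γ} :=
    measureReal_nonneg
  have hq2 : (stageLaw k Finset.univ ρ b).real {z | likelihoodRatio ρ z ≤ γ} ≤
      2 * (h ^ b) ^ 2 := by
    calc _ ≤ Real.sqrt γ * h ^ b := hq
      _ ≤ 2 * h ^ b * h ^ b := by gcongr
      _ = _ := by ring
  calc _ ≤ (2 * (h ^ b) ^ 2) ^ 2 := by gcongr
    _ = 4 * (h ^ 4) ^ b := by ring
    _ ≤ _ := by gcongr

/-! ### Deterministic properties of the procedure -/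

lemma Procedure.length_history {n : ℕ} (P : Procedure n) (u : ℕ → EuclideanSpace ℝ (Fin n))
    (t : ℕ) : (P.history u t).length = t := by
  induction t with
  | zero => rfl
  | succ t ih => simp [Procedure.history, ih]

lemma Procedure.obs_history {n : ℕ} (P : Procedure n) (u : ℕ → EuclideanSpace ℝ (Fin n))
    {s t : ℕ} (h : s < t) :
    (P.history u t).obs s = observe (P.query (P.history u s)) (u s) := by
  induction t with
  | zero => omega
  | succ t ih =>
    have hl := P.length_history u t
    rcases Nat.lt_succ_iff_lt_or_eq.1 h with h' | rfl
    · rw [← ih h']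
      simp only [History.obs, Procedure.history]
      rw [List.getD_append _ _ _ _ (by omega)]
    · simp only [History.obs, Procedure.history]
      rw [List.getD_append_right _ _ _ _ (by omega)]
      simp [hl]

lemma Procedure.sum_card_history {n : ℕ} (P : Procedure n) (u : ℕ → EuclideanSpace ℝ (Fin n))
    (t : ℕ) : ((P.history u t).map fun o => o.1.card).sum =
      ∑ s ∈ Finset.range t, (P.query (P.history u s)).card := by
  induction t with
  | zero => rfl
  | succ t ih => simp [Procedure.history, ih, Finset.sum_range_succ]

lemma mem_interval_index {n k : ℕ} (j : Fin (n / k)) (a : Fin k) :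
    (⟨(j : ℕ) * k + (a : ℕ), block_index_lt j a⟩ : Fin n) ∈ interval n k j := by
  have := a.isLt
  simp only [interval, Finset.mem_filter, Finset.mem_univ, true_and]
  constructor
  · omega
  · rw [add_mul]; omega

lemma card_interval_le {n k : ℕ} (j : Fin (n / k)) : (interval n k j).card ≤ k := by
  calc (interval n k j).card ≤ (Finset.Ico ((j : ℕ) * k) (((j : ℕ) + 1) * k)).card := by
        refine Finset.card_le_card_of_injOn (fun i => (i : ℕ)) ?_ (Fin.val_injective.injOn)
        intro i hi
        simpa [interval] using hi
    _ = k := by simp [add_mul]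

lemma block_observe_of_mem {n k : ℕ} {A : Finset (Fin (n / k))} {j : Fin (n / k)} (hj : j ∈ A)
    (u : EuclideanSpace ℝ (Fin n)) :
    block (observe (A.biUnion (interval n k)) u) j = block u j := by
  ext a
  have : (⟨(j : ℕ) * k + (a : ℕ), block_index_lt j a⟩ : Fin n) ∈ A.biUnion (interval n k) :=
    Finset.mem_biUnion.2 ⟨j, hj, mem_interval_index j a⟩
  simp only [block, observe]
  exact if_pos this

/-- An eliminated interval is never examined again, so only the blocks of current survivors matter.
This is why the zeros recorded at unqueried coordinates are harmless. -/
lemma survivors_congr {n k : ℕ} {ρ : ℝ} {b : ℕ} {x y : ℕ → EuclideanSpace ℝ (Fin n)} {r : ℕ}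
    (h : ∀ r' < r, ∀ j ∈ survivors n k ρ b x r', ∀ t < b,
      block (y (r' * b + t)) j = block (x (r' * b + t)) j) :
    survivors n k ρ b y r = survivors n k ρ b x r := by
  induction r with
  | zero => rfl
  | succ r ih =>
    simp only [survivors]
    rw [ih fun r' hr' => h r' (by omega)]
    refine Finset.filter_congr fun j hj => ?_
    have : (fun t : Fin b => block (y (r * b + (t : ℕ))) j) =
        fun t : Fin b => block (x (r * b + (t : ℕ))) j :=
      funext fun t => h r (by omega) j hj t t.isLt
    rw [this]

lemma totalSurvivors_mono {n k : ℕ} {ρ : ℝ} {b : ℕ} (x : ℕ → EuclideanSpace ℝ (Fin n)) :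
    Monotone (totalSurvivors n k ρ b x) := fun r s h =>
  Finset.sum_le_sum_of_subset (Finset.range_mono (by omega))

/-- The query of sequential thresholding, expressed with the underlying vectors. -/
def idealQuery (n k : ℕ) (ρ : ℝ) (K b : ℕ) (u : ℕ → EuclideanSpace ℝ (Fin n)) (t : ℕ) :
    Finset (Fin n) :=
  if t < K * b ∧ totalSurvivors n k ρ b u (t / b) ≤ 4 * (n / k) then
    (survivors n k ρ b u (t / b)).biUnion (interval n k)
  else ∅

lemma survivors_obs_of_query_eq {n k : ℕ} {ρ : ℝ} {K b : ℕ} {u : ℕ → EuclideanSpace ℝ (Fin n)}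
    {t : ℕ} (hq : ∀ s < t, (thresholdingProcedure n k ρ K b).query
      ((thresholdingProcedure n k ρ K b).history u s) = idealQuery n k ρ K b u s)
    {r : ℕ} (hr : r * b ≤ t) (hrK : r ≤ K)
    (hlow : ∀ r' < r, totalSurvivors n k ρ b u r' ≤ 4 * (n / k)) :
    survivors n k ρ b ((thresholdingProcedure n k ρ K b).history u t).obs r =
      survivors n k ρ b u r := by
  refine survivors_congr fun r' hr' j hj s hs => ?_
  have h1 : (r' + 1) * b ≤ r * b := Nat.mul_le_mul_right b hr'
  have h2 : r * b ≤ K * b := Nat.mul_le_mul_right b hrK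
  rw [add_mul, one_mul] at h1
  have hb : 0 < b := by omega
  have hdiv : (r' * b + s) / b = r' := by
    rw [mul_comm, Nat.mul_add_div hb, Nat.div_eq_of_lt hs, add_zero]
  rw [Procedure.obs_history _ _ (by omega), hq _ (by omega), idealQuery, hdiv,
    if_pos ⟨by omega, hlow r' hr'⟩, block_observe_of_mem hj]

lemma totalSurvivors_obs_of_query_eq {n k : ℕ} {ρ : ℝ} {K b : ℕ}
    {u : ℕ → EuclideanSpace ℝ (Fin n)}
    {t : ℕ} (hq : ∀ s < t, (thresholdingProcedure n k ρ K b).query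
      ((thresholdingProcedure n k ρ K b).history u s) = idealQuery n k ρ K b u s)
    {r : ℕ} (hr : r * b ≤ t) (hrK : r ≤ K)
    (hlow : ∀ r' < r, totalSurvivors n k ρ b u r' ≤ 4 * (n / k)) :
    totalSurvivors n k ρ b ((thresholdingProcedure n k ρ K b).history u t).obs r =
      totalSurvivors n k ρ b u r := by
  refine Finset.sum_congr rfl fun s hs => ?_
  have hs' : s ≤ r := by simpa [Nat.lt_succ_iff] using hs
  rw [survivors_obs_of_query_eq hq ((Nat.mul_le_mul_right b hs').trans hr) (hs'.trans hrK)
    fun r' hr' => hlow r' (by omega)]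

/-- After stopping, the recorded and the true survivors may differ. But the survivors at the first
overflow depend only on earlier, fully observed steps, so the two totals agree there; by
monotonicity both stay above the limit from then on. -/
lemma totalSurvivors_obs_le_iff {n k : ℕ} {ρ : ℝ} {K b : ℕ} {u : ℕ → EuclideanSpace ℝ (Fin n)}
    {t : ℕ} (hq : ∀ s < t, (thresholdingProcedure n k ρ K b).query
      ((thresholdingProcedure n k ρ K b).history u s) = idealQuery n k ρ K b u s)
    {r : ℕ} (hr : r * b ≤ t) (hrK : r ≤ K) :
    totalSurvivors n k ρ b ((thresholdingProcedure n k ρ K b).history u t).obs r ≤ 4 * (n / k) ↔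
      totalSurvivors n k ρ b u r ≤ 4 * (n / k) := by
  classical
  by_cases hlow : ∀ r' < r, totalSurvivors n k ρ b u r' ≤ 4 * (n / k)
  · rw [totalSurvivors_obs_of_query_eq hq hr hrK hlow]
  · have hex : ∃ r', ¬ totalSurvivors n k ρ b u r' ≤ 4 * (n / k) := by
      push Not at hlow ⊢
      obtain ⟨r', -, h⟩ := hlow
      exact ⟨r', h⟩
    have hr0 : Nat.find hex < r := by
      push Not at hlow
      obtain ⟨r', h1, h2⟩ := hlow
      exact (Nat.find_min' hex (not_le.2 h2)).trans_lt h1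
    have hspec := Nat.find_spec hex
    have heq := totalSurvivors_obs_of_query_eq (r := Nat.find hex) hq
      ((Nat.mul_le_mul_right b hr0.le).trans hr) (hr0.le.trans hrK)
      fun r' hr' => not_not.1 (Nat.find_min hex hr')
    have m1 := totalSurvivors_mono (k := k) (ρ := ρ) (b := b) u hr0.le
    have m2 := totalSurvivors_mono (k := k) (ρ := ρ) (b := b)
      ((thresholdingProcedure n k ρ K b).history u t).obs hr0.le
    constructor <;> intro h <;> omega

/-- Strong induction on the round: if all earlier queries were the ideal ones, the history
determines the same survivors as the full vectors, or the same decision to stop. -/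
lemma query_history {n k : ℕ} {ρ : ℝ} {K b : ℕ} (u : ℕ → EuclideanSpace ℝ (Fin n)) (t : ℕ) :
    (thresholdingProcedure n k ρ K b).query ((thresholdingProcedure n k ρ K b).history u t) =
      idealQuery n k ρ K b u t := by
  induction t using Nat.strong_induction_on with
  | _ t hq =>
    have hunf : (thresholdingProcedure n k ρ K b).query
        ((thresholdingProcedure n k ρ K b).history u t) =
        if t < K * b ∧ totalSurvivors n k ρ b
            ((thresholdingProcedure n k ρ K b).history u t).obs (t / b) ≤ 4 * (n / k) then
          (survivors n k ρ b ((thresholdingProcedure n k ρ K b).history u t).obs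
            (t / b)).biUnion (interval n k)
        else ∅ := by
      conv_lhs => rw [thresholdingProcedure]
      simp only [Procedure.length_history]
      rfl
    rw [hunf, idealQuery]
    by_cases ht : t < K * b
    · have hrK : t / b ≤ K := (Nat.div_lt_of_lt_mul (by rwa [mul_comm])).le
      have hiff := totalSurvivors_obs_le_iff hq (Nat.div_mul_le_self t b) hrK
      by_cases hT : totalSurvivors n k ρ b u (t / b) ≤ 4 * (n / k)
      · rw [if_pos ⟨ht, hiff.2 hT⟩, if_pos ⟨ht, hT⟩,
          survivors_obs_of_query_eq hq (Nat.div_mul_le_self t b) hrK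
            fun r' hr' => (totalSurvivors_mono u hr'.le).trans hT]
      · rw [if_neg fun h => hT (hiff.1 h.2), if_neg fun h => hT h.2]
    · rw [if_neg fun h => ht h.1, if_neg fun h => ht h.1]

lemma decision_history_iff {n k : ℕ} {ρ : ℝ} {K b T : ℕ} (hT : K * b ≤ T)
    (u : ℕ → EuclideanSpace ℝ (Fin n)) :
    (thresholdingProcedure n k ρ K b).decision
        ((thresholdingProcedure n k ρ K b).history u T) = true ↔
      totalSurvivors n k ρ b u K ≤ 4 * (n / k) ∧ (survivors n k ρ b u K).Nonempty := by
  have hq : ∀ s < T, _ := fun s _ => query_history (n := n) (k := k) (ρ := ρ) (K := K) (b := b) u s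
  have hiff := totalSurvivors_obs_le_iff hq hT le_rfl
  have hunf : (thresholdingProcedure n k ρ K b).decision
      ((thresholdingProcedure n k ρ K b).history u T) = decide (totalSurvivors n k ρ b
        ((thresholdingProcedure n k ρ K b).history u T).obs K ≤ 4 * (n / k) ∧
      (survivors n k ρ b ((thresholdingProcedure n k ρ K b).history u T).obs K).Nonempty) := rfl
  rw [hunf, decide_eq_true_iff, hiff]
  refine and_congr_right fun h => ?_
  rw [survivors_obs_of_query_eq hq hT le_rfl
    fun r' hr' => (totalSurvivors_mono u hr'.le).trans h]

lemma sum_range_mul_div {K b : ℕ} (g : ℕ → ℕ) :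
    ∑ s ∈ Finset.range (K * b), g (s / b) = b * ∑ r ∈ Finset.range K, g r := by
  rcases Nat.eq_zero_or_pos b with rfl | hb
  · simp
  induction K with
  | zero => simp
  | succ K ih =>
    rw [add_mul, one_mul, Finset.sum_range_add, ih, Finset.sum_range_succ, mul_add]
    congr 1
    rw [Finset.sum_congr rfl (g := fun _ => g K)]
    · simp
    · intro s hs
      rw [mul_comm, Nat.mul_add_div hb, Nat.div_eq_of_lt (Finset.mem_range.1 hs), add_zero]

/-- Only stages whose running total is within the limit count, and the total at the last such stage
dominates the whole sum. -/
lemma sum_card_survivors_of_total_le {n k : ℕ} {ρ : ℝ} {b : ℕ}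
    (u : ℕ → EuclideanSpace ℝ (Fin n)) (B R : ℕ) :
    ∑ r ∈ Finset.range R, (if totalSurvivors n k ρ b u r ≤ B then
      (survivors n k ρ b u r).card else 0) ≤ B := by
  induction R with
  | zero => simp
  | succ R ih =>
    by_cases h : totalSurvivors n k ρ b u R ≤ B
    · refine le_trans (Finset.sum_le_sum fun r _ => ?_) h
      split_ifs <;> simp
    · rw [Finset.sum_range_succ, if_neg h, add_zero]
      exact ih

/-- At most 4(n/k) interval visits are paid for, each costing b rounds of at most k coordinates. The
sum is at most 4bn, and b = M / (4n) rounds down. -/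
lemma hasBudget_thresholdingProcedure (n k : ℕ) (ρ : ℝ) (K M : ℕ) :
    (thresholdingProcedure n k ρ K (M / (4 * n))).HasBudget M := by
  intro u
  set b := M / (4 * n) with hb
  rw [Procedure.sum_card_history]
  simp only [query_history]
  set g : ℕ → ℕ := fun r => if totalSurvivors n k ρ b u r ≤ 4 * (n / k) then
      (survivors n k ρ b u r).card else 0 with hg
  have hcard : ∀ s, (idealQuery n k ρ K b u s).card ≤
      if s < K * b then k * g (s / b) else 0 := by
    intro s
    by_cases h1 : s < K * b
    · by_cases h2 : totalSurvivors n k ρ b u (s / b) ≤ 4 * (n / k)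
      · simp only [idealQuery, hg, h1, h2, and_self, if_true]
        rw [mul_comm]
        exact Finset.card_biUnion_le_card_mul _ _ _ fun j _ => card_interval_le j
      · simp [idealQuery, h2]
    · simp [idealQuery, h1]
  calc ∑ s ∈ Finset.range M, (idealQuery n k ρ K b u s).card
      ≤ ∑ s ∈ Finset.range M, (if s < K * b then k * g (s / b) else 0) :=
        Finset.sum_le_sum fun s _ => hcard s
    _ = ∑ s ∈ (Finset.range M).filter (· < K * b), k * g (s / b) := by
        rw [Finset.sum_filter]
    _ ≤ ∑ s ∈ Finset.range (K * b), k * g (s / b) :=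
        Finset.sum_le_sum_of_subset fun s hs => by
          simp only [Finset.mem_filter, Finset.mem_range] at hs ⊢
          exact hs.2
    _ = k * (b * ∑ r ∈ Finset.range K, g r) := by
        rw [← Finset.mul_sum, sum_range_mul_div]
    _ ≤ k * (b * (4 * (n / k))) := by
        gcongr
        exact sum_card_survivors_of_total_le u _ K
    _ = b * (4 * (n / k * k)) := by ring
    _ ≤ b * (4 * n) := by
        gcongr
        exact Nat.div_mul_le_self n k
    _ ≤ M := Nat.div_mul_le_self M (4 * n)

/-- The recursion decouples: survival of an interval depends on its own data only, which makes the
survival events of distinct intervals independent. -/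
lemma mem_survivors_iff {n k : ℕ} {ρ : ℝ} {b : ℕ} {x : ℕ → EuclideanSpace ℝ (Fin n)} {r : ℕ}
    {j : Fin (n / k)} :
    j ∈ survivors n k ρ b x r ↔ ∀ s < r, threshold k ρ b <
      likelihoodRatio ρ fun t : Fin b => block (x (s * b + (t : ℕ))) j := by
  induction r with
  | zero => simp [survivors]
  | succ r ih =>
    simp only [survivors, Finset.mem_filter, ih, Nat.lt_succ_iff_lt_or_eq]
    constructor
    · rintro ⟨h1, h2⟩ s (hs | rfl)
      · exact h1 s hs
      · exact h2
    · exact fun h => ⟨fun s hs => h s (Or.inl hs), h r (Or.inr rfl)⟩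

/-! ### The joint law of the observations of all intervals -/

/-- The index of the `a`-th coordinate of the `j`-th interval. -/
def blockIndex {n k : ℕ} (j : Fin (n / k)) (a : Fin k) : Fin n :=
  ⟨(j : ℕ) * k + (a : ℕ), block_index_lt j a⟩

lemma blockIndex_mem_interval_iff {n k : ℕ} {i j : Fin (n / k)} {a : Fin k} :
    blockIndex i a ∈ interval n k j ↔ i = j := by
  constructor
  · intro h
    simp only [interval, blockIndex, Finset.mem_filter, Finset.mem_univ, true_and] at h
    have ha := a.isLt
    have hk : 0 < k := by omega
    have h1 : (j : ℕ) < i + 1 := by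
      refine Nat.lt_of_mul_lt_mul_right (a := k) ?_
      rw [add_mul]
      omega
    have h2 : (i : ℕ) < j + 1 := by
      refine Nat.lt_of_mul_lt_mul_right (a := k) ?_
      omega
    ext
    omega
  · rintro rfl
    exact mem_interval_index i a

lemma blockIndex_inj {n k : ℕ} {i j : Fin (n / k)} {a b : Fin k} :
    blockIndex i a = blockIndex j b ↔ i = j ∧ a = b := by
  constructor
  · intro h
    obtain rfl : i = j := by
      rw [← blockIndex_mem_interval_iff (a := a), h, blockIndex_mem_interval_iff]
    refine ⟨rfl, ?_⟩
    simp only [blockIndex, Fin.mk.injEq] at h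
    ext
    omega
  · rintro ⟨rfl, rfl⟩
    rfl

/-- `S` consists of the sets `T j` of coordinates of the `j`-th intervals, and at most one of these
sets is nonempty. -/
def IsBlockSet {n k : ℕ} (S : Finset (Fin n)) (T : Fin (n / k) → Finset (Fin k)) : Prop :=
  ∀ i j a b, blockIndex i a ∈ S ∧ blockIndex j b ∈ S ↔ i = j ∧ a ∈ T i ∧ b ∈ T i

lemma isBlockSet_empty (n k : ℕ) :
    IsBlockSet (∅ : Finset (Fin n)) (fun _ : Fin (n / k) => (∅ : Finset (Fin k))) := by
  intro i j a b
  simp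

lemma isBlockSet_interval {n k : ℕ} (j₀ : Fin (n / k)) :
    IsBlockSet (interval n k j₀) fun j => if j = j₀ then Finset.univ else ∅ := by
  intro i j a b
  rw [blockIndex_mem_interval_iff, blockIndex_mem_interval_iff]
  by_cases hi : i = j₀
  · simp [hi, eq_comm]
  · simp [hi]

lemma IsBlockSet.corrMatrix_apply {n k : ℕ} {S : Finset (Fin n)}
    {T : Fin (n / k) → Finset (Fin k)} (h : IsBlockSet S T) (ρ : ℝ) (i j : Fin (n / k))
    (a b : Fin k) :
    corrMatrix S ρ (blockIndex i a) (blockIndex j b) =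
      if i = j then corrMatrix (T i) ρ a b else 0 := by
  simp only [corrMatrix, Matrix.of_apply, blockIndex_inj, h i j a b]
  by_cases hij : i = j <;> simp [hij]

/-- Restriction to the `j`-th interval as a continuous linear map. -/
def blockCLM {n k : ℕ} (j : Fin (n / k)) : EuclideanSpace ℝ (Fin n) →L[ℝ] EuclideanSpace ℝ (Fin k) :=
  LinearMap.toContinuousLinearMap
    { toFun := fun x => block x j
      map_add' := fun x y => by ext a; simp [block]
      map_smul' := fun c x => by ext a; simp [block] }

lemma blockCLM_apply {n k : ℕ} (j : Fin (n / k)) (x : EuclideanSpace ℝ (Fin n)) :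
    blockCLM j x = block x j := rfl

lemma measurable_block {n k : ℕ} (j : Fin (n / k)) :
    Measurable fun x : EuclideanSpace ℝ (Fin n) => block x j :=
  (blockCLM j).continuous.measurable

lemma IsBlockSet.map_block {n k : ℕ} {S : Finset (Fin n)}
    {T : Fin (n / k) → Finset (Fin k)} (h : IsBlockSet S T) {ρ : ℝ} (h0 : 0 < ρ) (h1 : ρ < 1)
    (j : Fin (n / k)) :
    (sampleLaw S ρ).map (fun x => block x j) = sampleLaw (T j) ρ := by
  have hS := (posDef_corrMatrix S h0.le h1).posSemidef
  have hT := (posDef_corrMatrix (T j) h0.le h1).posSemidef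
  unfold sampleLaw
  change Measure.map (blockCLM j) _ = _
  apply IsGaussian.ext
  · simp only [id_eq, integral_id_multivariateGaussian]
    rw [ContinuousLinearMap.integral_id_map, integral_id_multivariateGaussian, map_zero]
    exact IsGaussian.integrable_id
  rw [← ContinuousLinearMap.toBilinForm_inj]
  refine LinearMap.BilinForm.ext_basis (EuclideanSpace.basisFun (Fin k) ℝ).toBasis fun a b => ?_
  rw [ContinuousLinearMap.toBilinForm_apply, ContinuousLinearMap.toBilinForm_apply,
    covarianceBilin_apply_eq_cov, covariance_map]
  · have (a : Fin k) : (fun u => inner ℝ ((EuclideanSpace.basisFun (Fin k) ℝ).toBasis a) u) ∘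
        (blockCLM j : EuclideanSpace ℝ (Fin n) → _) = fun u => u (blockIndex j a) := by
      ext u
      simp [blockCLM_apply, block, blockIndex, PiLp.inner_apply]
    simp_rw [this, covariance_eval_multivariateGaussian hS,
      covarianceBilin_multivariateGaussian hT]
    rw [h.corrMatrix_apply]
    simp
  any_goals exact Measurable.aestronglyMeasurable (by fun_prop)
  · fun_prop
  · exact IsGaussian.memLp_two_id

/-- Jointly Gaussian blocks with vanishing cross-covariances are independent. -/
lemma IsBlockSet.iIndepFun_block {n k : ℕ} {S : Finset (Fin n)}
    {T : Fin (n / k) → Finset (Fin k)} (h : IsBlockSet S T) {ρ : ℝ} (h0 : 0 < ρ) (h1 : ρ < 1) :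
    iIndepFun (fun (j : Fin (n / k)) x => block x j) (sampleLaw S ρ) := by
  have hS := (posDef_corrMatrix S h0.le h1).posSemidef
  have hG : IsGaussian (sampleLaw S ρ) := by unfold sampleLaw; infer_instance
  have hX : HasGaussianLaw (fun (x : EuclideanSpace ℝ (Fin n)) (j : Fin (n / k)) (a : Fin k) =>
      x (blockIndex j a)) (sampleLaw S ρ) := by
    have := (IsGaussian.hasGaussianLaw_id (μ := sampleLaw S ρ)).map_fun
      (ContinuousLinearMap.pi fun j : Fin (n / k) => ContinuousLinearMap.pi fun a : Fin k =>
        (EuclideanSpace.proj (blockIndex j a) : EuclideanSpace ℝ (Fin n) →L[ℝ] ℝ))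
    exact this
  have hI := hX.iIndepFun_of_covariance_eval
    (X := fun j a (x : EuclideanSpace ℝ (Fin n)) => x (blockIndex j a)) fun i j hij a b => by
    rw [sampleLaw, covariance_eval_multivariateGaussian hS, h.corrMatrix_apply, if_neg hij]
  exact hI.comp (fun _ z => WithLp.toLp 2 z) fun _ => (PiLp.continuous_toLp 2 _).measurable

/-- The observations arranged by interval, step, and repetition. -/
def stages (n k b : ℕ) (x : ℕ → EuclideanSpace ℝ (Fin n)) :
    Fin (n / k) → ℕ → Fin b → EuclideanSpace ℝ (Fin k) :=
  fun j r t => block (x (r * b + t)) j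

lemma measurable_stages (n k b : ℕ) : Measurable (stages n k b) :=
  measurable_pi_lambda _ fun j => measurable_pi_lambda _ fun _ => measurable_pi_lambda _ fun _ =>
    (measurable_block j).comp (measurable_pi_apply _)

instance {n : ℕ} (S : Finset (Fin n)) (ρ : ℝ) : IsProbabilityMeasure (pathLaw S ρ) := by
  unfold pathLaw
  infer_instance

/-- The law of the observations of one interval. -/
def intervalLaw (k : ℕ) (T : Finset (Fin k)) (ρ : ℝ) (b : ℕ) :
    Measure (ℕ → Fin b → EuclideanSpace ℝ (Fin k)) :=
  Measure.infinitePi fun _ => stageLaw k T ρ b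

instance (k : ℕ) (T : Finset (Fin k)) (ρ : ℝ) (b : ℕ) :
    IsProbabilityMeasure (intervalLaw k T ρ b) := by
  unfold intervalLaw
  infer_instance

/-- Independence over rounds and over intervals is merged into one family indexed by pairs, then
regrouped by interval, step and repetition through currying. -/
lemma IsBlockSet.map_stages {n k : ℕ} {S : Finset (Fin n)}
    {T : Fin (n / k) → Finset (Fin k)} (h : IsBlockSet S T) {ρ : ℝ} (h0 : 0 < ρ) (h1 : ρ < 1)
    (b : ℕ) :
    (pathLaw S ρ).map (stages n k b) = Measure.infinitePi fun j => intervalLaw k (T j) ρ b := by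
  have hm : ∀ (t : ℕ) (j : Fin (n / k)),
      Measurable fun x : ℕ → EuclideanSpace ℝ (Fin n) => block (x t) j :=
    fun t j => (measurable_block j).comp (measurable_pi_apply t)
  have hlaw : ∀ (t : ℕ) (j : Fin (n / k)),
      (pathLaw S ρ).map (fun x => block (x t) j) = sampleLaw (T j) ρ := by
    intro t j
    rw [← h.map_block h0 h1 j, ← Measure.infinitePi_map_eval (fun _ : ℕ => sampleLaw S ρ) t,
      Measure.map_map (measurable_block j) (measurable_pi_apply t)]
    rfl
  have hI : iIndepFun (fun (p : ℕ × Fin (n / k)) (x : ℕ → EuclideanSpace ℝ (Fin n)) =>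
      block (x p.1) p.2) (pathLaw S ρ) := by
    refine iIndepFun_uncurry' (X := fun t j (x : ℕ → EuclideanSpace ℝ (Fin n)) => block (x t) j)
      hm ?_ fun t => ?_
    · exact iIndepFun_infinitePi (P := fun _ : ℕ => sampleLaw S ρ)
        (X := fun _ (y : EuclideanSpace ℝ (Fin n)) (j : Fin (n / k)) => block y j)
        fun _ => measurable_pi_lambda _ fun j => measurable_block j
    · rw [iIndepFun_iff_map_fun_eq_infinitePi_map (hm t)]
      have hI' := (iIndepFun_iff_map_fun_eq_infinitePi_map
        (fun j : Fin (n / k) => measurable_block j)).1 (h.iIndepFun_block h0 h1)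
      have e : (fun (x : ℕ → EuclideanSpace ℝ (Fin n)) (j : Fin (n / k)) => block (x t) j) =
          (fun (y : EuclideanSpace ℝ (Fin n)) (j : Fin (n / k)) => block y j) ∘ fun x => x t := rfl
      rw [e, ← Measure.map_map (measurable_pi_lambda _ fun j => measurable_block j)
        (measurable_pi_apply t), pathLaw, Measure.infinitePi_map_eval, hI']
      congr 1
      funext j
      rw [h.map_block h0 h1]
      exact (hlaw t j).symm
  -- Distinct steps use disjoint sets of rounds: r * b + t with t < b determines r and t.
  set g : Fin (n / k) × ℕ × Fin b → ℕ × Fin (n / k) := fun q => (q.2.1 * b + q.2.2, q.1) with hg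
  have hginj : Function.Injective g := by
    rintro ⟨j, r, t⟩ ⟨j', r', t'⟩ hq
    simp only [hg, Prod.mk.injEq] at hq
    obtain ⟨hq, rfl⟩ := hq
    have ht := t.isLt
    have ht' := t'.isLt
    have hb : 0 < b := by omega
    have e1 : r = r' := by
      have := congrArg (· / b) hq
      simpa [mul_comm _ b, Nat.mul_add_div hb, Nat.div_eq_of_lt ht, Nat.div_eq_of_lt ht'] using this
    subst e1
    have e2 : t = t' := by
      ext
      omega
    rw [e2]
  have hI2 := hI.precomp hginj
  have hlaw2 := (iIndepFun_iff_map_fun_eq_infinitePi_map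
    (fun q : Fin (n / k) × ℕ × Fin b => hm (g q).1 (g q).2)).1 hI2
  simp only [hlaw] at hlaw2
  have e : stages n k b = (fun (w : Fin (n / k) → ℕ × Fin b → EuclideanSpace ℝ (Fin k)) j =>
        MeasurableEquiv.curry ℕ (Fin b) (EuclideanSpace ℝ (Fin k)) (w j)) ∘
      (MeasurableEquiv.curry (Fin (n / k)) (ℕ × Fin b) (EuclideanSpace ℝ (Fin k))) ∘
      fun x (q : Fin (n / k) × ℕ × Fin b) => block (x (g q).1) (g q).2 := rfl
  have hm3 : Measurable fun (x : ℕ → EuclideanSpace ℝ (Fin n)) (q : Fin (n / k) × ℕ × Fin b) =>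
      block (x (g q).1) (g q).2 := measurable_pi_lambda _ fun q => hm _ _
  rw [e, ← Measure.map_map (by fun_prop) (by fun_prop), ← Measure.map_map (by fun_prop) hm3, hlaw2,
    Measure.infinitePi_map_curry (fun j (_ : ℕ × Fin b) => sampleLaw (T j) ρ),
    Measure.infinitePi_map_pi _ (fun _ => by fun_prop)]
  congr 1
  funext j
  rw [Measure.infinitePi_map_curry (fun (_ : ℕ) (_ : Fin b) => sampleLaw (T j) ρ), intervalLaw,
    stageLaw]
  simp_rw [Measure.infinitePi_eq_pi]

/-! ### Survival of an interval -/

/-- The outcomes of one step for which the interval is kept. -/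
def keepSet (k : ℕ) (ρ : ℝ) (b : ℕ) : Set (Fin b → EuclideanSpace ℝ (Fin k)) :=
  {z | threshold k ρ b < likelihoodRatio ρ z}

lemma measurableSet_keepSet (k : ℕ) (ρ : ℝ) (b : ℕ) : MeasurableSet (keepSet k ρ b) :=
  measurableSet_lt measurable_const (measurable_likelihoodRatio ρ)

/-- The observations of an interval for which it survives the first `r` steps. -/
def surviveSet (k : ℕ) (ρ : ℝ) (b r : ℕ) : Set (ℕ → Fin b → EuclideanSpace ℝ (Fin k)) :=
  (Finset.range r : Set ℕ).pi fun _ => keepSet k ρ b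

lemma measurableSet_surviveSet (k : ℕ) (ρ : ℝ) (b r : ℕ) : MeasurableSet (surviveSet k ρ b r) :=
  MeasurableSet.pi (Finset.range r).countable_toSet fun _ _ => measurableSet_keepSet k ρ b

lemma mem_survivors_iff_mem_surviveSet {n k : ℕ} {ρ : ℝ} {b : ℕ}
    {x : ℕ → EuclideanSpace ℝ (Fin n)} {r : ℕ} {j : Fin (n / k)} :
    j ∈ survivors n k ρ b x r ↔ stages n k b x j ∈ surviveSet k ρ b r := by
  rw [mem_survivors_iff]
  simp only [surviveSet, Set.mem_pi, Finset.coe_range, Set.mem_Iio]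
  rfl

lemma intervalLaw_surviveSet (k : ℕ) (T : Finset (Fin k)) (ρ : ℝ) (b r : ℕ) :
    intervalLaw k T ρ b (surviveSet k ρ b r) = stageLaw k T ρ b (keepSet k ρ b) ^ r := by
  rw [intervalLaw, surviveSet, Measure.infinitePi_pi _ fun _ _ => measurableSet_keepSet k ρ b]
  simp

lemma intervalLaw_surviveSet_compl_le (k : ℕ) (T : Finset (Fin k)) (ρ : ℝ) (b r : ℕ) :
    intervalLaw k T ρ b (surviveSet k ρ b r)ᶜ ≤ r * stageLaw k T ρ b (keepSet k ρ b)ᶜ := by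
  have hsub : (surviveSet k ρ b r)ᶜ ⊆ ⋃ s ∈ Finset.range r,
      (fun w : ℕ → Fin b → EuclideanSpace ℝ (Fin k) => w s) ⁻¹' (keepSet k ρ b)ᶜ := by
    intro w hw
    simpa [surviveSet] using hw
  calc _ ≤ _ := measure_mono hsub
    _ ≤ ∑ s ∈ Finset.range r, intervalLaw k T ρ b
        ((fun w : ℕ → Fin b → EuclideanSpace ℝ (Fin k) => w s) ⁻¹' (keepSet k ρ b)ᶜ) :=
      measure_biUnion_finset_le _ _
    _ = ∑ s ∈ Finset.range r, stageLaw k T ρ b (keepSet k ρ b)ᶜ := by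
      refine Finset.sum_congr rfl fun s _ => ?_
      exact (measurePreserving_eval_infinitePi (fun _ : ℕ => stageLaw k T ρ b) s).measure_preimage
        (measurableSet_keepSet k ρ b).compl.nullMeasurableSet
    _ = _ := by simp

lemma IsBlockSet.pathLaw_stages_preimage {n k : ℕ} {S : Finset (Fin n)}
    {T : Fin (n / k) → Finset (Fin k)} (h : IsBlockSet S T) {ρ : ℝ} (h0 : 0 < ρ) (h1 : ρ < 1)
    {b : ℕ} (j : Fin (n / k)) {A : Set (ℕ → Fin b → EuclideanSpace ℝ (Fin k))}
    (hA : MeasurableSet A) :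
    pathLaw S ρ {x | stages n k b x j ∈ A} = intervalLaw k (T j) ρ b A := by
  rw [← Measure.infinitePi_map_eval (fun j => intervalLaw k (T j) ρ b) j, ← h.map_stages h0 h1,
    Measure.map_map (measurable_pi_apply j) (measurable_stages n k b),
    Measure.map_apply ((measurable_pi_apply j).comp (measurable_stages n k b)) hA]
  rfl

/-- The number of stages `0, …, K` at which an interval is still present. -/
def stageCount (k : ℕ) (ρ : ℝ) (b K : ℕ) (w : ℕ → Fin b → EuclideanSpace ℝ (Fin k)) : ℝ :=
  ∑ s ∈ Finset.range (K + 1), (surviveSet k ρ b s).indicator 1 w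

lemma measurable_stageCount (k : ℕ) (ρ : ℝ) (b K : ℕ) : Measurable (stageCount k ρ b K) :=
  Finset.measurable_sum _ fun s _ => measurable_one.indicator (measurableSet_surviveSet k ρ b s)

lemma stageCount_nonneg (k : ℕ) (ρ : ℝ) (b K : ℕ) (w : ℕ → Fin b → EuclideanSpace ℝ (Fin k)) :
    0 ≤ stageCount k ρ b K w :=
  Finset.sum_nonneg fun _ _ => Set.indicator_nonneg (fun _ _ => zero_le_one) _

lemma stageCount_le (k : ℕ) (ρ : ℝ) (b K : ℕ) (w : ℕ → Fin b → EuclideanSpace ℝ (Fin k)) :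
    stageCount k ρ b K w ≤ K + 1 := by
  calc stageCount k ρ b K w ≤ ∑ s ∈ Finset.range (K + 1), (1 : ℝ) :=
        Finset.sum_le_sum fun s _ => Set.indicator_le_self' (fun _ _ => zero_le_one) w
    _ = K + 1 := by simp

lemma totalSurvivors_eq_sum_stageCount {n k : ℕ} {ρ : ℝ} {b : ℕ}
    (x : ℕ → EuclideanSpace ℝ (Fin n)) (K : ℕ) :
    (totalSurvivors n k ρ b x K : ℝ) = ∑ j, stageCount k ρ b K (stages n k b x j) := by
  classical
  simp only [totalSurvivors, stageCount]
  rw [Finset.sum_comm, Nat.cast_sum]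
  refine Finset.sum_congr rfl fun s _ => ?_
  rw [Finset.card_eq_sum_ones, Nat.cast_sum]
  simp only [Set.indicator_apply, ← mem_survivors_iff_mem_surviveSet]
  simp

lemma integral_stageCount_le (k : ℕ) (ρ : ℝ) (b K : ℕ) :
    ∫ w, stageCount k ρ b K w ∂(intervalLaw k ∅ ρ b) ≤ 2 := by
  have hp : stageLaw k ∅ ρ b (keepSet k ρ b) ≤ 1 / 2 := stageLaw_empty_threshold_lt k ρ b
  have hp' : (stageLaw k ∅ ρ b (keepSet k ρ b)).toReal ≤ 1 / 2 := by
    have := ENNReal.toReal_mono (by simp) hp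
    simpa using this
  simp only [stageCount]
  have hint : ∀ s ∈ Finset.range (K + 1), Integrable
      (fun w => (surviveSet k ρ b s).indicator (1 : (ℕ → Fin b → EuclideanSpace ℝ (Fin k)) → ℝ) w) (intervalLaw k ∅ ρ b) := fun s _ =>
    (integrable_const (1 : ℝ)).indicator (measurableSet_surviveSet k ρ b s)
  rw [integral_finsetSum _ hint]
  calc ∑ s ∈ Finset.range (K + 1), ∫ w, (surviveSet k ρ b s).indicator 1 w ∂(intervalLaw k ∅ ρ b)
      = ∑ s ∈ Finset.range (K + 1), (stageLaw k ∅ ρ b (keepSet k ρ b)).toReal ^ s := by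
        refine Finset.sum_congr rfl fun s _ => ?_
        rw [integral_indicator_one (measurableSet_surviveSet k ρ b s), measureReal_def,
          intervalLaw_surviveSet, ENNReal.toReal_pow]
    _ ≤ ∑ s ∈ Finset.range (K + 1), (1 / 2 : ℝ) ^ s :=
        Finset.sum_le_sum fun s _ => pow_le_pow_left₀ ENNReal.toReal_nonneg hp' s
    _ ≤ 2 := sum_geometric_two_le _

/-- The possibly contaminated interval is removed from the sum, since it contributes at most K + 1 ≤
N. The clean ones have total mean at most 2N, so passing 4N needs a deviation of at least N, while
the variance is at most N (K+1)^2. -/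
lemma measure_sum_stageCount_gt_le {N k : ℕ} (hN : 0 < N) {T : Fin N → Finset (Fin k)} {j₀ : Fin N}
    (hT : ∀ j, j ≠ j₀ → T j = ∅) (ρ : ℝ) (b K : ℕ) (hK : K + 1 ≤ N) :
    (Measure.infinitePi fun j => intervalLaw k (T j) ρ b)
      {y | (4 * N : ℝ) < ∑ j, stageCount k ρ b K (y j)} ≤
      ENNReal.ofReal (((K : ℝ) + 1) ^ 2 / N) := by
  classical
  set Q := Measure.infinitePi fun j => intervalLaw k (T j) ρ b with hQ
  set Z : Fin N → (Fin N → ℕ → Fin b → EuclideanSpace ℝ (Fin k)) → ℝ :=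
    fun j y => stageCount k ρ b K (y j) with hZ
  have hZm : ∀ j, Measurable (Z j) := fun j =>
    (measurable_stageCount k ρ b K).comp (measurable_pi_apply j)
  have hZb : ∀ j, ∀ᵐ y ∂Q, Z j y ∈ Set.Icc (0 : ℝ) (K + 1) := fun j =>
    Eventually.of_forall fun y => ⟨stageCount_nonneg _ _ _ _ _, stageCount_le _ _ _ _ _⟩
  have hZL : ∀ j, MemLp (Z j) 2 Q := fun j =>
    memLp_of_bounded (hZb j) (hZm j).aestronglyMeasurable 2
  have hZI : iIndepFun Z Q := iIndepFun_infinitePi fun _ => measurable_stageCount k ρ b K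
  set s : Finset (Fin N) := Finset.univ.erase j₀ with hs
  have hcard : (s.card : ℝ) ≤ N := by
    have : s.card ≤ N := (Finset.card_le_univ s).trans (by simp)
    exact_mod_cast this
  have hmean : ∀ j ∈ s, Q[Z j] ≤ 2 := by
    intro j hj
    have h1 : Q[Z j] = ∫ w, stageCount k ρ b K w ∂(intervalLaw k (T j) ρ b) := by
      rw [← Measure.infinitePi_map_eval (fun j => intervalLaw k (T j) ρ b) j, integral_map
        (measurable_pi_apply j).aemeasurable (measurable_stageCount k ρ b K).aestronglyMeasurable]
    rw [h1, hT j (Finset.ne_of_mem_erase hj)]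
    exact integral_stageCount_le k ρ b K
  have hX : MemLp (∑ j ∈ s, Z j) 2 Q := memLp_finsetSum' s fun j _ => hZL j
  have hEX : ∫ y, (∑ j ∈ s, Z j) y ∂Q ≤ 2 * (N : ℝ) := by
    simp only [Finset.sum_apply]
    rw [integral_finsetSum _ fun j _ => (hZL j).integrable one_le_two]
    calc _ ≤ ∑ j ∈ s, (2 : ℝ) := Finset.sum_le_sum hmean
      _ = 2 * s.card := by simp [mul_comm]
      _ ≤ _ := by gcongr
  have hVar : variance (∑ j ∈ s, Z j) Q ≤ N * ((K : ℝ) + 1) ^ 2 := by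
    rw [IndepFun.variance_sum (fun j _ => hZL j) fun i _ j _ hij => hZI.indepFun hij]
    calc _ ≤ ∑ j ∈ s, ((K : ℝ) + 1) ^ 2 := by
          refine Finset.sum_le_sum fun j _ => ?_
          refine (variance_le_sq_of_bounded (hZb j) (hZm j).aemeasurable).trans ?_
          rw [sub_zero]
          exact pow_le_pow_left₀ (by positivity) (by
            have : (0 : ℝ) ≤ K := Nat.cast_nonneg K
            linarith) 2
      _ = s.card * ((K : ℝ) + 1) ^ 2 := by simp
      _ ≤ _ := by gcongr
  have hNr : (0 : ℝ) < N := by exact_mod_cast hN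
  have hKr : (K : ℝ) + 1 ≤ N := by exact_mod_cast hK
  have hsub : {y | (4 * N : ℝ) < ∑ j, stageCount k ρ b K (y j)} ⊆
      {y | (N : ℝ) ≤ |(∑ j ∈ s, Z j) y - ∫ y, (∑ j ∈ s, Z j) y ∂Q|} := by
    intro y hy
    have h1 : ∑ j, stageCount k ρ b K (y j) = Z j₀ y + ∑ j ∈ s, Z j y :=
      (Finset.add_sum_erase _ (fun j => Z j y) (Finset.mem_univ j₀)).symm
    have h2 : Z j₀ y ≤ K + 1 := stageCount_le _ _ _ _ _
    simp only [Set.mem_ofPred_eq] at hy ⊢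
    refine le_trans ?_ (le_abs_self _)
    have h3 : (∑ j ∈ s, Z j) y = ∑ j ∈ s, Z j y := Finset.sum_apply _ _ _
    linarith
  refine (measure_mono hsub).trans ((meas_ge_le_variance_div_sq hX hNr).trans ?_)
  refine ENNReal.ofReal_le_ofReal ?_
  rw [div_le_div_iff₀ (by positivity) hNr]
  calc _ ≤ N * ((K : ℝ) + 1) ^ 2 * N := by gcongr
    _ = _ := by ring

/-! ### The risk of sequential thresholding -/

lemma pathLaw_empty_decision_le {n k M K b : ℕ} {ρ : ℝ} (h0 : 0 < ρ) (h1 : ρ < 1)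
    (hM : K * b ≤ M) :
    pathLaw ∅ ρ {u | (thresholdingProcedure n k ρ K b).decision
        ((thresholdingProcedure n k ρ K b).history u M) ≠ false} ≤
      ENNReal.ofReal (((n / k : ℕ) : ℝ) * (1 / 2) ^ K) := by
  have hsub : {u | (thresholdingProcedure n k ρ K b).decision
      ((thresholdingProcedure n k ρ K b).history u M) ≠ false} ⊆
      ⋃ j : Fin (n / k), {x | stages n k b x j ∈ surviveSet k ρ b K} := by
    intro u hu
    simp only [Set.mem_ofPred_eq, ne_eq, Bool.not_eq_false] at hu
    obtain ⟨j, hj⟩ := ((decision_history_iff hM u).1 hu).2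
    exact Set.mem_iUnion.2 ⟨j, mem_survivors_iff_mem_surviveSet.1 hj⟩
  calc _ ≤ _ := measure_mono hsub
    _ ≤ ∑ j : Fin (n / k), pathLaw ∅ ρ {x | stages n k b x j ∈ surviveSet k ρ b K} :=
      measure_iUnion_fintype_le _ _
    _ ≤ ∑ j : Fin (n / k), (1 / 2 : ℝ≥0∞) ^ K := by
      refine Finset.sum_le_sum fun j _ => ?_
      rw [(isBlockSet_empty n k).pathLaw_stages_preimage h0 h1 j (measurableSet_surviveSet k ρ b K),
        intervalLaw_surviveSet]
      gcongr
      exact stageLaw_empty_threshold_lt k ρ b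
    _ = ENNReal.ofReal (((n / k : ℕ) : ℝ) * (1 / 2) ^ K) := by
      rw [ENNReal.ofReal_mul (by positivity), ENNReal.ofReal_pow (by positivity),
        ENNReal.ofReal_natCast, ENNReal.ofReal_div_of_pos two_pos]
      simp

/-- No detection forces one of two events: the contaminated interval is eliminated at some step, or
the total overflows. -/
lemma pathLaw_interval_decision_le {n k M K b : ℕ} {ρ : ℝ} (h0 : 0 < ρ) (h1 : ρ < 1)
    (hM : K * b ≤ M) (hK : K + 1 ≤ n / k) (j₀ : Fin (n / k)) :
    pathLaw (interval n k j₀) ρ {u | (thresholdingProcedure n k ρ K b).decision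
        ((thresholdingProcedure n k ρ K b).history u M) ≠ true} ≤
      ENNReal.ofReal (K * (stageLaw k Finset.univ ρ b).real
          {z | likelihoodRatio ρ z ≤ threshold k ρ b}) +
        ENNReal.ofReal (((K : ℝ) + 1) ^ 2 / (n / k : ℕ)) := by
  have hB := isBlockSet_interval j₀
  have hsub : {u | (thresholdingProcedure n k ρ K b).decision
      ((thresholdingProcedure n k ρ K b).history u M) ≠ true} ⊆
      {x | stages n k b x j₀ ∈ (surviveSet k ρ b K)ᶜ} ∪ stages n k b ⁻¹'
        {y | (4 * (n / k : ℕ) : ℝ) < ∑ j, stageCount k ρ b K (y j)} := by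
    intro u hu
    by_contra hcon
    simp only [Set.mem_union, Set.mem_ofPred_eq, Set.mem_compl_iff, Set.mem_preimage, not_or,
      not_not, not_lt, ← totalSurvivors_eq_sum_stageCount] at hcon
    refine hu ((decision_history_iff hM u).2
      ⟨?_, j₀, mem_survivors_iff_mem_surviveSet.2 hcon.1⟩)
    exact_mod_cast hcon.2
  have hmeas : MeasurableSet {y : Fin (n / k) → ℕ → Fin b → EuclideanSpace ℝ (Fin k) |
      (4 * (n / k : ℕ) : ℝ) < ∑ j, stageCount k ρ b K (y j)} :=
    measurableSet_lt measurable_const (Finset.measurable_sum _ fun j _ =>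
      (measurable_stageCount k ρ b K).comp (measurable_pi_apply j))
  refine (measure_mono hsub).trans ((measure_union_le _ _).trans (add_le_add ?_ ?_))
  · rw [hB.pathLaw_stages_preimage h0 h1 j₀ (measurableSet_surviveSet k ρ b K).compl, if_pos rfl]
    refine (intervalLaw_surviveSet_compl_le k _ ρ b K).trans (le_of_eq ?_)
    rw [ENNReal.ofReal_mul (by positivity), ENNReal.ofReal_natCast, ofReal_measureReal]
    congr 2
    ext z
    simp [keepSet]
  · rw [← Measure.map_apply (measurable_stages n k b) hmeas, hB.map_stages h0 h1]
    exact measure_sum_stageCount_gt_le (by omega) (fun j hj => if_neg hj) ρ b K hK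

lemma risk_thresholdingProcedure_le {n k M K b : ℕ} {ρ : ℝ} (hk : 1 ≤ k) (h0 : 0 < ρ) (h1 : ρ < 1)
    (hM : K * b ≤ M) (hK : K + 1 ≤ n / k) :
    (thresholdingProcedure n k ρ K b).risk M (disjointIntervals n k) ρ ≤
      ENNReal.ofReal (((n / k : ℕ) : ℝ) * (1 / 2) ^ K +
        (2 * Real.sqrt ((K : ℝ) ^ 2 *
          ((1 + ((k : ℝ) - 1) * ρ) / (1 + ((k : ℝ) - 1) * ρ / 2) ^ 2) ^ b) +
        ((K : ℝ) + 1) ^ 2 / (n / k : ℕ))) := by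
  rw [ENNReal.ofReal_add (by positivity) (by positivity),
    ENNReal.ofReal_add (by positivity) (by positivity)]
  refine add_le_add (pathLaw_empty_decision_le h0 h1 hM) (iSup₂_le fun S hS => ?_)
  obtain ⟨j₀, -, rfl⟩ := Finset.mem_image.1 hS
  refine (pathLaw_interval_decision_le h0 h1 hM hK j₀).trans (add_le_add ?_ le_rfl)
  refine ENNReal.ofReal_le_ofReal ?_
  have hq := stageLaw_univ_le_threshold hk h0 h1 b
  set B := ((1 + ((k : ℝ) - 1) * ρ) / (1 + ((k : ℝ) - 1) * ρ / 2) ^ 2) ^ b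
  have h4 : 2 * Real.sqrt ((K : ℝ) ^ 2 * B) = Real.sqrt ((K : ℝ) ^ 2 * (4 * B)) := by
    rw [mul_left_comm, Real.sqrt_mul (by norm_num) ((K : ℝ) ^ 2 * B),
      show (4 : ℝ) = 2 ^ 2 by norm_num, Real.sqrt_sq two_pos.le]
  rw [h4]
  refine Real.le_sqrt_of_sq_le ?_
  rw [mul_pow]
  gcongr

/-! ### Asymptotics -/

/-- The floor loses at most 1 from m/4, which is absorbed once m ≥ 8. -/
lemma div_eight_le_natCast_div {n M : ℕ} (hm : 8 ≤ (M : ℝ) / n) :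
    (M : ℝ) / n / 8 ≤ ((M / (4 * n) : ℕ) : ℝ) := by
  have h := Nat.sub_one_lt_floor ((M : ℝ) / ((4 * n : ℕ) : ℝ))
  rw [Nat.floor_div_eq_div] at h
  have e : (M : ℝ) / ((4 * n : ℕ) : ℝ) = (M : ℝ) / n / 4 := by
    push_cast
    rw [mul_comm, div_div]
  rw [e] at h
  linarith

/-- The factor is at most 4/(1+x) ≤ 8/y, and 8/y ≤ y^(-1/2) exactly when y ≥ 64. With b ≥ m/8 the
exponent is at least (m/16) log y, whence 48 = 3 · 16. -/
lemma likelihood_factor_pow_le_of_large {x y L m : ℝ} {b : ℕ} (hx : 0 ≤ x) (hy : 64 ≤ y)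
    (hxy : y / 2 ≤ 1 + x) (hb : m / 8 ≤ b) (hL : 48 * L ≤ m * Real.log y) :
    ((1 + x) / (1 + x / 2) ^ 2) ^ b ≤ Real.exp (-3 * L) := by
  have hy0 : 0 < y := by linarith
  have hlog : 0 ≤ Real.log y := Real.log_nonneg (by linarith)
  have hsq : 8 ≤ Real.sqrt y := Real.le_sqrt_of_sq_le (by norm_num; exact hy)
  have hexp : Real.exp (-(1 / 2) * Real.log y) = (Real.sqrt y)⁻¹ := by
    rw [Real.sqrt_eq_rpow, Real.rpow_def_of_pos hy0, ← Real.exp_neg]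
    congr 1
    ring
  have h1 : (1 + x) / (1 + x / 2) ^ 2 ≤ Real.exp (-(1 / 2) * Real.log y) := by
    rw [hexp]
    calc (1 + x) / (1 + x / 2) ^ 2 ≤ 4 / (1 + x) := by
          rw [div_le_div_iff₀ (by positivity) (by positivity)]
          nlinarith
      _ ≤ 8 / y := by
          rw [div_le_div_iff₀ (by positivity) hy0]
          linarith
      _ ≤ (Real.sqrt y)⁻¹ := by
          rw [inv_eq_one_div, div_le_div_iff₀ hy0 (by positivity)]
          nlinarith [Real.mul_self_sqrt hy0.le]
  calc _ ≤ (Real.exp (-(1 / 2) * Real.log y)) ^ b := by gcongr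
    _ = Real.exp (b * (-(1 / 2) * Real.log y)) := (Real.exp_nat_mul _ _).symm
    _ ≤ _ := by
      refine Real.exp_le_exp.2 ?_
      nlinarith [mul_le_mul_of_nonneg_right hb hlog]

lemma likelihood_factor_pow_le_of_small {x y L m : ℝ} {b : ℕ} (hy : 0 ≤ y) (hx : x ≤ 1)
    (hxy : y / 2 ≤ x) (hb : m / 8 ≤ b) (hm : 0 ≤ m) (hL0 : 0 ≤ L)
    (hL : 30 * Real.sqrt L ≤ y * Real.sqrt m) :
    ((1 + x) / (1 + x / 2) ^ 2) ^ b ≤ Real.exp (-3 * L) := by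
  have hx0 : 0 ≤ x := by linarith
  have hsq : 900 * L ≤ y ^ 2 * m := by
    have := pow_le_pow_left₀ (by positivity) hL 2
    rw [mul_pow, mul_pow, Real.sq_sqrt hL0, Real.sq_sqrt hm] at this
    linarith
  have h1 : (1 + x) / (1 + x / 2) ^ 2 ≤ Real.exp (-(x ^ 2 / 9)) := by
    refine le_trans ?_ (Real.add_one_le_exp _)
    rw [div_le_iff₀ (by positivity)]
    -- The claim reduces to (2 + x)^2 ≤ 9, that is (1 - x)(x + 5) ≥ 0, after multiplication by x^2.
    nlinarith [mul_nonneg (sq_nonneg x) (mul_nonneg (sub_nonneg.2 hx) (by linarith : 0 ≤ x + 5))]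
  calc _ ≤ (Real.exp (-(x ^ 2 / 9))) ^ b := by gcongr
    _ = Real.exp (b * (-(x ^ 2 / 9))) := (Real.exp_nat_mul _ _).symm
    _ ≤ _ := by
      refine Real.exp_le_exp.2 ?_
      have h2 : y ^ 2 / 4 ≤ x ^ 2 := by nlinarith
      -- The exponent is at least m y^2 / 288, and 30^2 = 900 exceeds 3 · 288 = 864.
      have h3 : m / 8 * (y ^ 2 / 4) ≤ b * x ^ 2 := by gcongr
      nlinarith

/-- The number of steps of sequential thresholding with `N` intervals. -/
def stepCount (ε : ℝ) (N : ℕ) : ℕ := ⌊(1 + ε) * Real.logb 2 (N : ℝ)⌋₊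

lemma stepCount_le {ε : ℝ} (hε : 0 < ε) (N : ℕ) :
    (stepCount ε N : ℝ) ≤ (1 + ε) / Real.log 2 * Real.log N := by
  have h : 0 ≤ (1 + ε) * Real.logb 2 (N : ℝ) := by
    have : 0 ≤ Real.logb 2 (N : ℝ) :=
      div_nonneg (Real.log_natCast_nonneg N) (Real.log_nonneg one_le_two)
    positivity
  refine (Nat.floor_le h).trans (le_of_eq ?_)
  rw [Real.logb]
  ring

lemma tendsto_mul_half_pow_stepCount {ε : ℝ} (hε : 0 < ε) :
    Tendsto (fun N : ℕ => (N : ℝ) * (1 / 2) ^ stepCount ε N) atTop (𝓝 0) := by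
  have hlim : Tendsto (fun N : ℕ => 2 * (N : ℝ) ^ (-ε)) atTop (𝓝 0) := by
    have := ((tendsto_rpow_neg_atTop hε).comp tendsto_natCast_atTop_atTop).const_mul 2
    simpa using this
  refine squeeze_zero' (Eventually.of_forall fun N => by positivity) ?_ hlim
  filter_upwards [eventually_gt_atTop 0] with N hN
  have hN' : (0 : ℝ) < N := by exact_mod_cast hN
  -- Rounding K down costs at most one step, hence the factor 2 in the bound for 2^(-K).
  have h := (Nat.sub_one_lt_floor ((1 + ε) * Real.logb 2 (N : ℝ))).le
  have h1 : ((1 / 2 : ℝ)) ^ stepCount ε N ≤ 2 * (N : ℝ) ^ (-(1 + ε)) := by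
    calc ((1 / 2 : ℝ)) ^ stepCount ε N = (2 : ℝ) ^ (-(stepCount ε N : ℝ)) := by
          rw [Real.rpow_neg two_pos.le, Real.rpow_natCast, one_div, inv_pow]
      _ ≤ (2 : ℝ) ^ (1 + Real.logb 2 (N : ℝ) * (-(1 + ε))) := by
          refine Real.rpow_le_rpow_of_exponent_le one_le_two ?_
          rw [stepCount]
          linarith
      _ = 2 * (N : ℝ) ^ (-(1 + ε)) := by
          rw [Real.rpow_add two_pos, Real.rpow_one, Real.rpow_mul two_pos.le,
            Real.rpow_logb two_pos (by norm_num) hN']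
  calc (N : ℝ) * (1 / 2) ^ stepCount ε N ≤ N * (2 * (N : ℝ) ^ (-(1 + ε))) := by gcongr
    _ = 2 * ((N : ℝ) ^ (1 : ℝ) * (N : ℝ) ^ (-(1 + ε))) := by rw [Real.rpow_one]; ring
    _ = 2 * (N : ℝ) ^ (-ε) := by
      rw [← Real.rpow_add hN']
      congr 2
      ring

lemma tendsto_stepCount_sq_div {ε : ℝ} (hε : 0 < ε) :
    Tendsto (fun N : ℕ => ((stepCount ε N : ℝ) + 1) ^ 2 / N) atTop (𝓝 0) := by
  set c := (1 + ε) / Real.log 2 with hc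
  have hlog : Tendsto (fun N : ℕ => Real.log (N : ℝ)) atTop atTop :=
    Real.tendsto_log_atTop.comp tendsto_natCast_atTop_atTop
  have hlim : Tendsto (fun N : ℕ => (c + 1) ^ 2 * (Real.log (N : ℝ) ^ 2 / N)) atTop (𝓝 0) := by
    have h := ((Real.isLittleO_pow_log_id_atTop (n := 2)).tendsto_div_nhds_zero.comp
      tendsto_natCast_atTop_atTop).const_mul ((c + 1) ^ 2)
    simpa using h
  refine squeeze_zero' (Eventually.of_forall fun N => by positivity) ?_ hlim
  filter_upwards [hlog.eventually_ge_atTop 1] with N hN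
  have h1 : (stepCount ε N : ℝ) + 1 ≤ (c + 1) * Real.log N := by
    have := stepCount_le hε N
    linarith
  calc ((stepCount ε N : ℝ) + 1) ^ 2 / N ≤ ((c + 1) * Real.log N) ^ 2 / N := by gcongr
    _ = _ := by ring

lemma sequentialThresholding_eq (n k M : ℕ) (ρ ε : ℝ) :
    sequentialThresholding n k M ρ ε =
      thresholdingProcedure n k ρ (stepCount ε (n / k)) (M / (4 * n)) := rfl

lemma eventually_risk_le {ε : ℝ} (hε : 0 < ε) {n k M : ℕ → ℕ} {ρ : ℕ → ℝ}
    (hk : Tendsto k atTop atTop) (hN : Tendsto (fun ν => n ν / k ν) atTop atTop)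
    (hρ0 : ∀ ν, 0 < ρ ν) (hρ : Tendsto ρ atTop (𝓝 0)) :
    ∀ᶠ ν in atTop, (sequentialThresholding (n ν) (k ν) (M ν) (ρ ν) ε).risk (M ν)
        (disjointIntervals (n ν) (k ν)) (ρ ν) ≤
      ENNReal.ofReal (((n ν / k ν : ℕ) : ℝ) * (1 / 2) ^ stepCount ε (n ν / k ν) +
        (2 * Real.sqrt ((stepCount ε (n ν / k ν) : ℝ) ^ 2 *
          ((1 + ((k ν : ℝ) - 1) * ρ ν) / (1 + ((k ν : ℝ) - 1) * ρ ν / 2) ^ 2) ^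
            (M ν / (4 * n ν))) +
        ((stepCount ε (n ν / k ν) : ℝ) + 1) ^ 2 / (n ν / k ν : ℕ))) := by
  filter_upwards [hk.eventually_ge_atTop 1, hN.eventually_ge_atTop 1,
    hρ.eventually (gt_mem_nhds one_pos),
    ((tendsto_stepCount_sq_div hε).comp hN).eventually (gt_mem_nhds one_pos)] with ν hk1 hN1 hρ1 hK
  have hK' : stepCount ε (n ν / k ν) + 1 ≤ n ν / k ν := by
    have hNr : (0 : ℝ) < (n ν / k ν : ℕ) := by exact_mod_cast hN1
    simp only [Function.comp_apply] at hK
    rw [div_lt_one hNr] at hK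
    have h2 : (stepCount ε (n ν / k ν) + 1) ^ 2 < n ν / k ν := by exact_mod_cast hK
    nlinarith
  rw [sequentialThresholding_eq]
  refine risk_thresholdingProcedure_le hk1 (hρ0 ν) hρ1 ?_ hK'
  have h3 : n ν / k ν ≤ n ν := Nat.div_le_self _ _
  calc stepCount ε (n ν / k ν) * (M ν / (4 * n ν)) ≤ (4 * n ν) * (M ν / (4 * n ν)) :=
        Nat.mul_le_mul_right _ (by omega)
    _ ≤ M ν := Nat.mul_div_le _ _

/-- With ℓ = log(n/k), the hypothesis bounds the likelihood factor by ℓ^(-3). Since K = O(ℓ), the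
quantity under the square root is O(1/ℓ); the exponent 3 is chosen to exceed the 2 coming from K^2.
-/
lemma tendsto_risk_of_eventually_le {ε : ℝ} (hε : 0 < ε) {n k M : ℕ → ℕ} {ρ : ℕ → ℝ}
    (hk : Tendsto k atTop atTop) (hR : Tendsto (fun ν => (n ν : ℝ) / (k ν : ℝ)) atTop atTop)
    (hρ0 : ∀ ν, 0 < ρ ν) (hρ : Tendsto ρ atTop (𝓝 0))
    (hfac : ∀ᶠ ν in atTop, ((1 + ((k ν : ℝ) - 1) * ρ ν) /
        (1 + ((k ν : ℝ) - 1) * ρ ν / 2) ^ 2) ^ (M ν / (4 * n ν)) ≤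
      Real.exp (-3 * Real.log (Real.log ((n ν : ℝ) / (k ν : ℝ))))) :
    Tendsto (fun ν => (sequentialThresholding (n ν) (k ν) (M ν) (ρ ν) ε).risk (M ν)
      (disjointIntervals (n ν) (k ν)) (ρ ν)) atTop (𝓝 0) := by
  have hN : Tendsto (fun ν => n ν / k ν) atTop atTop := by
    have h := tendsto_nat_floor_atTop.comp hR
    refine h.congr fun ν => ?_
    exact Nat.floor_div_eq_div _ _
  have hℓ : Tendsto (fun ν => Real.log ((n ν : ℝ) / (k ν : ℝ))) atTop atTop :=
    Real.tendsto_log_atTop.comp hR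
  set c := (1 + ε) / Real.log 2 with hc
  have hmid : Tendsto (fun ν => (stepCount ε (n ν / k ν) : ℝ) ^ 2 *
      ((1 + ((k ν : ℝ) - 1) * ρ ν) / (1 + ((k ν : ℝ) - 1) * ρ ν / 2) ^ 2) ^
        (M ν / (4 * n ν))) atTop (𝓝 0) := by
    have hlim : Tendsto (fun ν => c ^ 2 * (Real.log ((n ν : ℝ) / (k ν : ℝ)))⁻¹) atTop (𝓝 0) := by
      have := (tendsto_inv_atTop_zero.comp hℓ).const_mul (c ^ 2)
      simpa using this
    refine squeeze_zero' ?_ ?_ hlim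
    · filter_upwards [hk.eventually_ge_atTop 1] with ν hk1
      have h1 : (1 : ℝ) ≤ k ν := by exact_mod_cast hk1
      have h2 : 0 ≤ ((k ν : ℝ) - 1) * ρ ν := mul_nonneg (by linarith) (hρ0 ν).le
      positivity
    · filter_upwards [hfac, hℓ.eventually_ge_atTop 1, hN.eventually_ge_atTop 1] with ν h1 h2 h3
      set ℓ := Real.log ((n ν : ℝ) / (k ν : ℝ))
      have hℓ0 : 0 < ℓ := by linarith
      have hKle : (stepCount ε (n ν / k ν) : ℝ) ≤ c * ℓ := by
        refine (stepCount_le hε _).trans ?_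
        have hc0 : 0 ≤ c := div_nonneg (by linarith) (Real.log_nonneg one_le_two)
        refine mul_le_mul_of_nonneg_left ?_ hc0
        exact Real.log_le_log (by exact_mod_cast h3) Nat.cast_div_le
      have hexp : Real.exp (-3 * Real.log ℓ) = (ℓ ^ 3)⁻¹ := by
        rw [neg_mul, Real.exp_neg, mul_comm, Real.exp_mul, Real.exp_log hℓ0]
        norm_cast
      rw [hexp] at h1
      calc _ ≤ (stepCount ε (n ν / k ν) : ℝ) ^ 2 * (ℓ ^ 3)⁻¹ := by gcongr
        _ ≤ (c * ℓ) ^ 2 * (ℓ ^ 3)⁻¹ := by gcongr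
        _ = c ^ 2 * ℓ⁻¹ := by field_simp
  have hsum := ((tendsto_mul_half_pow_stepCount hε).comp hN).add
    ((((Real.continuous_sqrt.tendsto 0).comp hmid).const_mul 2).add
      ((tendsto_stepCount_sq_div hε).comp hN))
  have hsum' := ENNReal.tendsto_ofReal hsum
  simp only [Real.sqrt_zero, mul_zero, add_zero, ENNReal.ofReal_zero] at hsum'
  exact tendsto_of_tendsto_of_tendsto_of_le_of_le' tendsto_const_nhds hsum'
    (Eventually.of_forall fun _ => zero_le) (eventually_risk_le hε hk hN hρ0 hρ)

end CorrDetect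

end

/-! ### The two regimes, with explicit constants. -/

theorem proposition2 :
    ∃ C₃ : ℝ, 0 < C₃ ∧ ∃ C₄ : ℝ, 0 < C₄ ∧
      ∀ (ε : ℝ), 0 < ε →
      ∀ (n k M : ℕ → ℕ) (ρ : ℕ → ℝ),
        Tendsto n atTop atTop →
        Tendsto k atTop atTop →
        Tendsto (fun ν => (M ν : ℝ) / (n ν : ℝ)) atTop atTop →
        Tendsto (fun ν => (k ν : ℝ) / (n ν : ℝ)) atTop (𝓝 0) →
        (∀ ν, 0 < ρ ν) →
        Tendsto ρ atTop (𝓝 0) →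
        ((Tendsto (fun ν => ρ ν * (k ν : ℝ)) atTop atTop ∧
            ∀ᶠ ν in atTop,
              C₃ * Real.log (Real.log ((n ν : ℝ) / (k ν : ℝ))) ≤
                (M ν : ℝ) / (n ν : ℝ) * Real.log (1 + ρ ν * (k ν : ℝ))) ∨
          (Tendsto (fun ν => ρ ν * (k ν : ℝ)) atTop (𝓝 0) ∧
            ∀ᶠ ν in atTop,
              C₄ * Real.sqrt (Real.log (Real.log ((n ν : ℝ) / (k ν : ℝ)))) ≤
                ρ ν * (k ν : ℝ) * Real.sqrt ((M ν : ℝ) / (n ν : ℝ)))) →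
        (∀ ν, (CorrDetect.sequentialThresholding (n ν) (k ν) (M ν) (ρ ν) ε).HasBudget (M ν)) ∧
          Tendsto
            (fun ν =>
              (CorrDetect.sequentialThresholding (n ν) (k ν) (M ν) (ρ ν) ε).risk (M ν)
                (CorrDetect.disjointIntervals (n ν) (k ν)) (ρ ν))
            atTop (𝓝 0) := by
  refine ⟨48, by norm_num, 30, by norm_num, fun ε hε n k M ρ hn hk hm hkn hρ0 hρ hcase =>
    ⟨fun ν => CorrDetect.hasBudget_thresholdingProcedure _ _ _ _ _, ?_⟩⟩
  have hR : Tendsto (fun ν => (n ν : ℝ) / (k ν : ℝ)) atTop atTop := by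
    have h : Tendsto (fun ν => (k ν : ℝ) / (n ν : ℝ)) atTop (𝓝[>] 0) := by
      refine tendsto_nhdsWithin_iff.2 ⟨hkn, ?_⟩
      filter_upwards [hk.eventually_ge_atTop 1, hn.eventually_ge_atTop 1] with ν h1 h2
      have h1' : (0 : ℝ) < k ν := by exact_mod_cast h1
      have h2' : (0 : ℝ) < n ν := by exact_mod_cast h2
      exact div_pos h1' h2'
    refine (tendsto_inv_nhdsGT_zero.comp h).congr fun ν => ?_
    simp
  refine CorrDetect.tendsto_risk_of_eventually_le hε hk hR hρ0 hρ ?_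
  rcases hcase with ⟨hlarge, hineq⟩ | ⟨hsmall, hineq⟩
  · filter_upwards [hineq, hk.eventually_ge_atTop 1, hm.eventually_ge_atTop 8,
      -- The lemma is used with y = 1 + ρk, so 63 gives y ≥ 64; ρ < 1/2 allows k - 1 in place of k
      -- at the cost of a factor 2.
      hlarge.eventually_ge_atTop 63, hρ.eventually (gt_mem_nhds (one_half_pos (α := ℝ)))]
      with ν h1 h2 h3 h4 h5
    have hk1 : (1 : ℝ) ≤ k ν := by exact_mod_cast h2
    refine CorrDetect.likelihood_factor_pow_le_of_large
      (mul_nonneg (by linarith) (hρ0 ν).le) (by linarith) ?_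
      (CorrDetect.div_eight_le_natCast_div h3) h1
    linarith
  · have hℓ : Tendsto (fun ν => Real.log (Real.log ((n ν : ℝ) / (k ν : ℝ)))) atTop atTop :=
      Real.tendsto_log_atTop.comp (Real.tendsto_log_atTop.comp hR)
    -- Here y = ρk, and k ≥ 2 is what yields (k - 1)ρ ≥ ρk/2.
    filter_upwards [hineq, hk.eventually_ge_atTop 2, hm.eventually_ge_atTop 8,
      hsmall.eventually (gt_mem_nhds one_pos), hℓ.eventually_ge_atTop 0] with ν h1 h2 h3 h4 h5
    have hk2 : (2 : ℝ) ≤ k ν := by exact_mod_cast h2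
    have hρν := hρ0 ν
    refine CorrDetect.likelihood_factor_pow_le_of_small
      (mul_nonneg hρν.le (by linarith)) ?_ ?_
      (CorrDetect.div_eight_le_natCast_div h3) (by linarith) h5 h1
    · linarith
    · nlinarith
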